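/- For a square complex matrix $A$ let $\rho(A)=\max_{\lambda\in\operatorname{spec}(A)}|\lambda|$ be its spectral radius. For an $n\times n$ complex matrix $M$, let $\|M_i\|_2$ be the Euclidean norm of its $i$-th row, and let its nonbacktracking matrix $B_M$ be the matrix with rows and columns indexed by the ordered pairs $ij$ of distinct elements of $[n]$ (the directed edges of the complete graph on $n$ vertices), with $$B_M[ij,k\ell]=\begin{cases}M_{k\ell}&\text{if } j=k \text{ and } i\neq \ell,\\ 0&\text{otherwise.}\end{cases}$$ (The spectral radius of the empty matrix is taken to be $0$.) A random $n\times n$ complex matrix $M$ is called a non-asymptotic Wigner matrix if it is Hermitian with zero diagonal, its entries $M_{ij}$, $i<j$, above the diagonal are independent (not necessarily identically distributed), and they satisfy $\mathbb E M_{ij}=0$, $\mathbb E|M_{ij}|^2=\frac1n$ and $\mathbb E|M_{ij}|^4\le\frac1n$. Theorem. (a) There is an absolute constant $C>1$ such that $\mathbb E\,\rho(B_M)^2\le C$ for every $n$ and every $n\times n$ non-asymptotic Wigner matrix $M$. (b) For every $\varepsilon>0$ there is a constant $C'(\varepsilon)>1$, depending only on $\varepsilon$, such that for every $n$ and every $n\times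 n$ non-asymptotic Wigner matrix $M$, with probability at least $1-\varepsilon$, $$\rho(M)\le C'(\varepsilon)\Bigl(1+\max_{i\in[n]}\|M_i\|_2\Bigr).$$ -/

import Mathlib

open MeasureTheory ProbabilityTheory
open scoped ENNReal

universe u

/-- The directed edges of the complete graph on `n` vertices: the ordered pairs of distinct
vertices. -/
abbrev DirEdge (n : ℕ) : Type := {e : Fin n × Fin n // e.1 ≠ e.2}

/-- The nonbacktracking matrix of an `n × n` matrix `M`: its entry at `(ij, kl)` is `M k l` if
`j = k` and `i ≠ l`, and `0` otherwise. -/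
def nonbacktrackingMatrix {n : ℕ} (M : Matrix (Fin n) (Fin n) ℂ) :
    Matrix (DirEdge n) (DirEdge n) ℂ :=
  Matrix.of fun e f =>
    if e.1.2 = f.1.1 ∧ e.1.1 ≠ f.1.2 then M f.1.1 f.1.2 else 0

/-- A random `n × n` complex matrix `M` on the probability space `(Ω, P)` is a non-asymptotic
Wigner matrix: it is Hermitian with zero diagonal, and its entries above the diagonal are
independent, centered, of variance `1 / n` and of absolute fourth moment at most `1 / n`. -/
structure IsNonasymptoticWigner {n : ℕ} {Ω : Type u} [MeasurableSpace Ω] (P : Measure Ω)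
    (M : Ω → Matrix (Fin n) (Fin n) ℂ) : Prop where
  measurable_entry : ∀ i j, Measurable fun ω => M ω i j
  isHermitian : ∀ ω, (M ω).IsHermitian
  diag_eq_zero : ∀ ω i, M ω i i = 0
  indep : iIndepFun (fun (p : {p : Fin n × Fin n // p.1 < p.2}) (ω : Ω) => M ω p.1.1 p.1.2) P
  mean_eq_zero : ∀ i j, i < j → ∫ ω, M ω i j ∂P = 0
  second_moment : ∀ i j, i < j → ∫ ω, ‖M ω i j‖ ^ 2 ∂P = 1 / (n : ℝ)
  integrable_fourth : ∀ i j, i < j → Integrable (fun ω => ‖M ω i j‖ ^ 4) P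
  fourth_moment : ∀ i j, i < j → ∫ ω, ‖M ω i j‖ ^ 4 ∂P ≤ 1 / (n : ℝ)

/-- The largest Euclidean norm of a row of `M`. -/
noncomputable def maxRowNorm {n : ℕ} (M : Matrix (Fin n) (Fin n) ℂ) : ℝ :=
  ⨆ i : Fin n, ‖WithLp.toLp 2 (M i)‖

/-!
The spectral radius of the nonbacktracking matrix `B` of `M` is read off from the polynomial
`det (1 + X B)`, whose coefficients are the sums of principal minors of `B`. A minor on a set `S` of
directed edges is a deterministic number `nbMinor S` times the product of the entries of `M` over
`S`, and each directed edge occurs at most once in it. An entry of `M` therefore occurs, up to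
conjugation, at most four times in the product of two minors: the second moments of the coefficients
only involve the moments of the entries of order at most four, although nothing is assumed about
higher ones. By Landau's inequality (`norm_sq_le_of_mem_spectrum`) every eigenvalue `λ` of `B`
satisfies `r ^ 2 |λ| ^ 2 ≤ ∑ k, r ^ (2 k) |a k| ^ 2`, where the `a k` are the coefficients, so it is
enough to bound the expectation of the right-hand side for a small absolute constant `r`
(`IsNonasymptoticWigner.integral_coeffEnergy_le`).

A pair `(S, T)` of edge sets contributes to this expectation only if every undirected edge of the
underlying graph `G` is used at least twice (the entries are centred), and then at most
`n ^ (-|G|) |nbMinor S| |nbMinor T|`. A minor vanishes if some vertex is incident to exactly one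
undirected edge of `S` (`nbMinor_eq_zero`), so that `G` has no vertex of degree one; and the minors
grow at most exponentially (`norm_nbMinor_le`), which is absorbed by `r`. There remains the sum of
`z ^ |G|` over the graphs without vertices of degree one, with `z` a small multiple of `1 / n`. It is
bounded (`sum_graph_card_incidentEdges_ne_one_le`): there is a centred bounded random variable `ξ`
all of whose other moments are at least one, hence the indicator of "no degree is one" is at most
`E ∏ v, ξ v ^ deg v` for independent copies `ξ v`, and the sum is at most
`E ∏ (1 + z ξ v ξ w) ≤ E exp (z (∑ v, ξ v) ^ 2 / 2)`, where `∑ v, ξ v` is subgaussian with variance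
of order `n`.

For the second bound, the Ihara-Bass formula attaches to a Hermitian matrix `H` with zero diagonal
the Hermitian matrices `bassMatrix H t`, close to `1 - H / t` for large `t`, which are singular only
if the real number `t` is an eigenvalue of the nonbacktracking matrix. By continuity they are
positive definite for all `t` beyond the nonbacktracking spectral radius and the row norms, which
bounds the quadratic form of `H` from above (`quadForm_le`), and that of `-H` likewise. Markov's
inequality for the coefficients completes the proof.
-/

/-! ### A root of a polynomial and the `ℓ²` norm of its coefficients -/

/-- Landau's inequality at a root `w`, for a polynomial with constant coefficient `1`: the tail
`∑ k ≥ 1` of the coefficients has to cancel the constant term, and Cauchy-Schwarz applies. -/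
theorem one_le_sum_norm_sq_mul_of_root (N : ℕ) (a : ℕ → ℂ) (w : ℂ) (h0 : a 0 = 1)
    (hw : ∑ k ∈ Finset.range (N + 1), a k * w ^ k = 0) :
    1 ≤ (∑ k ∈ Finset.range (N + 1), ‖a k‖ ^ 2) * ‖w‖ ^ 2 := by
  set A : ℝ := ∑ k ∈ Finset.range N, ‖a (k + 1)‖ ^ 2 with hA
  have hA0 : 0 ≤ A := Finset.sum_nonneg fun _ _ => by positivity
  have hsum : ∑ k ∈ Finset.range (N + 1), ‖a k‖ ^ 2 = A + 1 := by
    rw [Finset.sum_range_succ', h0]; simp [hA]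
  rw [hsum]
  by_cases hw1 : 1 ≤ ‖w‖
  · nlinarith [mul_self_nonneg ‖w‖]
  push Not at hw1
  set x := ‖w‖ with hx
  have hx0 : 0 ≤ x := norm_nonneg _
  rw [Finset.sum_range_succ', h0] at hw
  have h1 : (1 : ℝ) ≤ ∑ k ∈ Finset.range N, ‖a (k + 1)‖ * x ^ (k + 1) := by
    have : ‖∑ k ∈ Finset.range N, a (k + 1) * w ^ (k + 1)‖ = 1 := by
      have : ∑ k ∈ Finset.range N, a (k + 1) * w ^ (k + 1) = -1 := by
        linear_combination hw
      rw [this]; simp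
    rw [← this]
    refine (norm_sum_le _ _).trans (le_of_eq ?_)
    simp [hx]
  have h2 := Finset.sum_mul_sq_le_sq_mul_sq (Finset.range N) (fun k => ‖a (k + 1)‖)
    (fun k => x ^ (k + 1))
  have h3 : (∑ k ∈ Finset.range N, (x ^ (k + 1)) ^ 2) * (1 - x ^ 2) ≤ x ^ 2 := by
    have : (∑ k ∈ Finset.range N, (x ^ (k + 1)) ^ 2) = x ^ 2 * ∑ k ∈ Finset.range N, (x ^ 2) ^ k := by
      rw [Finset.mul_sum]; exact Finset.sum_congr rfl fun k _ => by ring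
    rw [this, mul_assoc, mul_comm (∑ k ∈ Finset.range N, _), mul_neg_geom_sum]
    nlinarith [pow_nonneg (sq_nonneg x) N, sq_nonneg x]
  have h4 : 0 < 1 - x ^ 2 := by nlinarith
  set G := ∑ k ∈ Finset.range N, (x ^ (k + 1)) ^ 2
  have h5 : 1 ≤ A * G := by
    have : (1 : ℝ) ≤ (∑ k ∈ Finset.range N, ‖a (k + 1)‖ * x ^ (k + 1)) ^ 2 := by nlinarith
    linarith
  nlinarith [mul_le_mul_of_nonneg_left h3 hA0, mul_le_mul_of_nonneg_right h5 h4.le]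

/-- The `k`-th elementary symmetric function of the eigenvalues, as a sum of principal minors. -/
noncomputable def sumPrincipalMinors {m : Type*} [Fintype m] [DecidableEq m] (B : Matrix m m ℂ)
    (k : ℕ) : ℂ :=
  ∑ s ∈ Finset.univ.powersetCard k,
    (B.submatrix (Subtype.val : s → m) (Subtype.val : s → m)).det

/-- The eigenvalues of `B` are the negative inverses of the roots of `det (1 + X B)`, whose
coefficients are the sums of principal minors. -/
theorem norm_sq_le_of_mem_spectrum {m : Type*} [Fintype m] [DecidableEq m] (B : Matrix m m ℂ)
    (r : ℝ) (hr : 0 < r) (lam : ℂ) (hlam : lam ∈ spectrum ℂ B) :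
    r ^ 2 * ‖lam‖ ^ 2 ≤
      ∑ k ∈ Finset.range (Fintype.card m + 1), r ^ (2 * k) * ‖sumPrincipalMinors B k‖ ^ 2 := by
  by_cases hl : lam = 0
  · subst hl
    simp only [norm_zero, ne_eq, OfNat.ofNat_ne_zero, not_false_eq_true, zero_pow, mul_zero]
    exact Finset.sum_nonneg fun _ _ => by positivity
  let p : Polynomial ℂ := (1 + (Polynomial.X : Polynomial ℂ) • B.map Polynomial.C).det
  have hcoeff : ∀ k, p.coeff k = sumPrincipalMinors B k := fun k =>
    Matrix.coeff_det_one_add_X_smul_eq_sum_minors B k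
  have hdeg : p.natDegree < Fintype.card m + 1 := by
    rw [Nat.lt_succ_iff, Polynomial.natDegree_le_iff_coeff_eq_zero]
    intro k hk
    rw [hcoeff, sumPrincipalMinors, Finset.powersetCard_eq_empty.2 (by simpa using hk)]
    simp
  have heval : ∀ z : ℂ, p.eval z = (1 + z • B).det := by
    intro z
    rw [← Polynomial.coe_evalRingHom, RingHom.map_det]
    congr 1
    ext i j
    by_cases hij : i = j <;> simp [hij, mul_comm (B _ _)]
  have h0 : p.coeff 0 = 1 := by
    rw [Polynomial.coeff_zero_eq_eval_zero, heval]; simp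
  have hroot : p.eval (-lam⁻¹) = 0 := by
    rw [heval]
    rw [spectrum.mem_iff, Matrix.isUnit_iff_isUnit_det, isUnit_iff_ne_zero, not_not] at hlam
    have : (1 + (-lam⁻¹) • B) = lam⁻¹ • (algebraMap ℂ (Matrix m m ℂ) lam - B) := by
      rw [Algebra.algebraMap_eq_smul_one, smul_sub, smul_smul, inv_mul_cancel₀ hl, one_smul,
        neg_smul, sub_eq_add_neg]
    rw [this, Matrix.det_smul, hlam, mul_zero]
  rw [Polynomial.eval_eq_sum_range' hdeg] at hroot
  have hrC : (r : ℂ) ≠ 0 := by exact_mod_cast hr.ne'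
  have key := one_le_sum_norm_sq_mul_of_root (Fintype.card m) (fun k => p.coeff k * (r : ℂ) ^ k)
    (-lam⁻¹ / r) (by simp [h0]) (by
      rw [← hroot]
      refine Finset.sum_congr rfl fun k _ => ?_
      rw [div_pow]
      field_simp)
  have hn : ‖-lam⁻¹ / (r : ℂ)‖ ^ 2 = (r ^ 2 * ‖lam‖ ^ 2)⁻¹ := by
    rw [norm_div, norm_neg, norm_inv, Complex.norm_real, Real.norm_of_nonneg hr.le, div_pow]
    field_simp
  have hpos : 0 < r ^ 2 * ‖lam‖ ^ 2 := by
    have := norm_pos_iff.2 hl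
    positivity
  rw [hn, ← div_eq_mul_inv, one_le_div hpos] at key
  refine key.trans (le_of_eq (Finset.sum_congr rfl fun k _ => ?_))
  rw [norm_mul, norm_pow, Complex.norm_real, Real.norm_of_nonneg hr.le, hcoeff]
  ring

/-! ### Principal minors of the unweighted nonbacktracking matrix -/

/-- The reversal of a directed edge. -/
def DirEdge.rev {n : ℕ} (e : DirEdge n) : DirEdge n := ⟨(e.1.2, e.1.1), e.2.symm⟩

/-- The principal minor, on the set `S` of directed edges, of the unweighted nonbacktracking matrix
of the complete graph. -/
noncomputable def nbMinor {n : ℕ} (S : Finset (DirEdge n)) : ℂ :=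
  (Matrix.of fun e f : S =>
    if e.1.1.2 = f.1.1.1 ∧ e.1.1.1 ≠ f.1.1.2 then (1 : ℂ) else 0).det

theorem det_submatrix_nonbacktrackingMatrix {n : ℕ} (M : Matrix (Fin n) (Fin n) ℂ)
    (S : Finset (DirEdge n)) :
    ((nonbacktrackingMatrix M).submatrix (Subtype.val : S → DirEdge n) Subtype.val).det =
      nbMinor S * ∏ f ∈ S, M f.1.1 f.1.2 := by
  rw [nbMinor, mul_comm, ← Finset.prod_coe_sort S (fun f => M f.1.1 f.1.2),
    ← Matrix.det_mul_row]
  congr 1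
  ext e f
  simp [nonbacktrackingMatrix]

/-- At a vertex `v` incident to a single undirected edge of `S`, a nonbacktracking walk in `S` is
stuck: the corresponding row or column vanishes. -/
theorem nbMinor_eq_zero {n : ℕ} (S : Finset (DirEdge n)) (e : DirEdge n) (he : e ∈ S) (v : Fin n)
    (hv : e.1.1 = v ∨ e.1.2 = v)
    (h : ∀ f ∈ S, f.1.1 = v ∨ f.1.2 = v → f = e ∨ f = e.rev) : nbMinor S = 0 := by
  rcases hv with hv | hv
  · refine Matrix.det_eq_zero_of_column_eq_zero ⟨e, he⟩ fun f => ?_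
    simp only [Matrix.of_apply, ite_eq_right_iff, and_imp]
    intro h1 h2
    rcases h f.1 f.2 (Or.inr (h1.trans hv)) with h3 | h3
    · rw [h3] at h1; exact absurd h1.symm e.2
    · rw [h3] at h2; exact absurd rfl h2
  · refine Matrix.det_eq_zero_of_row_eq_zero ⟨e, he⟩ fun f => ?_
    simp only [Matrix.of_apply, ite_eq_right_iff, and_imp]
    intro h1 h2
    rcases h f.1 f.2 (Or.inl (h1.symm.trans hv)) with h3 | h3
    · rw [h3] at h1; exact absurd h1.symm e.2
    · rw [h3] at h2; exact absurd rfl h2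

theorem Matrix.norm_det_le_prod_sum_norm {m : Type*} [Fintype m] [DecidableEq m]
    (A : Matrix m m ℂ) : ‖A.det‖ ≤ ∏ i, ∑ j, ‖A i j‖ := by
  rw [Finset.prod_univ_sum, ← Matrix.det_transpose, Matrix.det_apply]
  refine (norm_sum_le _ _).trans ?_
  rw [Fintype.piFinset_univ]
  calc ∑ σ : Equiv.Perm m, ‖Equiv.Perm.sign σ • ∏ i, A.transpose (σ i) i‖
      = ∑ σ : Equiv.Perm m, ∏ i, ‖A i (σ i)‖ := by
        refine Finset.sum_congr rfl fun σ _ => ?_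
        rw [Units.smul_def, zsmul_eq_mul, norm_mul, norm_prod]
        rcases Int.units_eq_one_or (Equiv.Perm.sign σ) with h | h <;> simp [h]
    _ = ∑ g ∈ Finset.univ.map ⟨fun σ : Equiv.Perm m => (σ : m → m), DFunLike.coe_injective⟩,
          ∏ i, ‖A i (g i)‖ := by rw [Finset.sum_map]; rfl
    _ ≤ ∑ g : m → m, ∏ i, ‖A i (g i)‖ :=
        Finset.sum_le_sum_of_subset_of_nonneg (Finset.subset_univ _)
          fun _ _ _ => Finset.prod_nonneg fun _ _ => norm_nonneg _

/-- The minors grow at most exponentially. The matrix is, up to sign, the Schur complement of a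
sparse matrix indexed by vertices and edges, whose Leibniz expansion has at most `4 ^ |S|` terms. -/
theorem norm_nbMinor_le {n : ℕ} (S : Finset (DirEdge n)) : ‖nbMinor S‖ ≤ 4 ^ S.card := by
  let Src : Matrix (Fin n) S ℂ := Matrix.of fun v f => if f.1.1.1 = v then 1 else 0
  let Tgt : Matrix S (Fin n) ℂ := Matrix.of fun e v => if e.1.1.2 = v then 1 else 0
  let R : Matrix S S ℂ := Matrix.of fun e f => if f.1 = e.1.rev then 1 else 0
  have hdet : (Matrix.fromBlocks 1 Src Tgt R).det = (-1) ^ S.card * nbMinor S := by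
    rw [Matrix.det_fromBlocks_one₁₁, nbMinor]
    conv_rhs => rw [show S.card = Fintype.card S by simp, ← Matrix.det_neg]
    congr 1
    ext e f
    simp only [Matrix.sub_apply, Matrix.mul_apply, Matrix.neg_apply, Matrix.of_apply, Src, Tgt, R,
      ite_mul, one_mul, zero_mul, Finset.sum_ite_eq, Finset.mem_univ, if_true]
    have : f.1 = e.1.rev ↔ e.1.1.2 = f.1.1.1 ∧ e.1.1.1 = f.1.1.2 := by
      rw [DirEdge.rev, Subtype.ext_iff, Prod.ext_iff]
      constructor
      · rintro ⟨h1, h2⟩; exact ⟨h1.symm, h2.symm⟩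
      · rintro ⟨h1, h2⟩; exact ⟨h1.symm, h2.symm⟩
    simp only [this, @eq_comm _ f.1.1.1]
    by_cases h1 : e.1.1.2 = f.1.1.1 <;> by_cases h2 : e.1.1.1 = f.1.1.2 <;>
      simp [h1, h2]
  have hle := Matrix.norm_det_le_prod_sum_norm (Matrix.fromBlocks 1 Src Tgt R)
  rw [hdet, norm_mul, norm_pow, norm_neg, norm_one, one_pow, one_mul, Fintype.prod_sum_type] at hle
  have hv : ∀ v : Fin n, ∑ j, ‖Matrix.fromBlocks 1 Src Tgt R (Sum.inl v) j‖ ≤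
      2 ^ (S.filter fun f => f.1.1 = v).card := by
    intro v
    rw [Fintype.sum_sum_type]
    have h1 : ∑ x : Fin n, ‖Matrix.fromBlocks 1 Src Tgt R (Sum.inl v) (Sum.inl x)‖ = 1 := by
      rw [Finset.sum_eq_single v] <;> simp +contextual [eq_comm]
    have h2 : ∑ x : S, ‖Matrix.fromBlocks 1 Src Tgt R (Sum.inl v) (Sum.inr x)‖ =
        (S.filter fun f => f.1.1 = v).card := by
      simp only [Matrix.fromBlocks_apply₁₂, Src, Matrix.of_apply, apply_ite norm, norm_one,
        norm_zero]
      rw [Finset.sum_coe_sort S (fun f => if f.1.1 = v then (1 : ℝ) else 0)]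
      simp
    rw [h1, h2]
    have := one_add_mul_le_pow (a := (1 : ℝ)) (by norm_num) (S.filter fun f => f.1.1 = v).card
    norm_num at this ⊢
    linarith
  have he : ∀ e : S, ∑ j, ‖Matrix.fromBlocks 1 Src Tgt R (Sum.inr e) j‖ ≤ 2 := by
    intro e
    rw [Fintype.sum_sum_type]
    have h1 : ∑ x : Fin n, ‖Matrix.fromBlocks 1 Src Tgt R (Sum.inr e) (Sum.inl x)‖ = 1 := by
      simp [Tgt, apply_ite norm]
    have h2 : ∑ x : S, ‖Matrix.fromBlocks 1 Src Tgt R (Sum.inr e) (Sum.inr x)‖ ≤ 1 := by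
      simp only [Matrix.fromBlocks_apply₂₂, R, Matrix.of_apply, apply_ite norm, norm_one,
        norm_zero]
      rw [Finset.sum_coe_sort S (fun f => if f = e.1.rev then (1 : ℝ) else 0)]
      rw [Finset.sum_ite_eq']
      split_ifs <;> norm_num
    linarith
  calc ‖nbMinor S‖ ≤ _ := hle
    _ ≤ (∏ v : Fin n, 2 ^ (S.filter fun f => f.1.1 = v).card) * ∏ _e : S, (2 : ℝ) := by
        refine mul_le_mul (Finset.prod_le_prod (fun _ _ => Finset.sum_nonneg fun _ _ =>
          norm_nonneg _) fun v _ => hv v) (Finset.prod_le_prod (fun _ _ => Finset.sum_nonneg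
          fun _ _ => norm_nonneg _) fun e _ => he e) (Finset.prod_nonneg fun _ _ =>
          Finset.sum_nonneg fun _ _ => norm_nonneg _) (by positivity)
    _ = 4 ^ S.card := by
        rw [Finset.prod_pow_eq_pow_sum,
          ← Finset.card_eq_sum_card_fiberwise (f := fun f : DirEdge n => f.1.1) (s := S)
            (t := Finset.univ) (fun _ _ => Finset.mem_coe.2 (Finset.mem_univ _))]
        simp only [Finset.prod_const, Finset.card_univ, Fintype.card_coe]
        rw [← mul_pow]; norm_num

/-! ### Counting graphs without vertices of degree one -/

theorem Real.exp_le_add_exp_sq (t : ℝ) : Real.exp t ≤ t + Real.exp (t ^ 2) := by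
  by_cases h1 : |t| ≤ 1
  · have h2 := (abs_le.1 (Real.abs_exp_sub_one_sub_id_le h1)).2
    have h3 := Real.add_one_le_exp (t ^ 2)
    linarith
  · push Not at h1
    rcases lt_abs.1 h1 with h | h
    · have : Real.exp t ≤ Real.exp (t ^ 2) := Real.exp_le_exp.2 (by nlinarith)
      linarith
    · have h2 : Real.exp t ≤ 1 := Real.exp_le_one_iff.2 (by linarith)
      have h3 := Real.add_one_le_exp (t ^ 2)
      nlinarith

/-- The undirected edges of the complete graph on `n` vertices. -/
abbrev UndirEdge (n : ℕ) : Type := {p : Fin n × Fin n // p.1 < p.2}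

/-- The edges of `G` that are incident to `v`. -/
def incidentEdges {n : ℕ} (G : Finset (UndirEdge n)) (v : Fin n) : Finset (UndirEdge n) :=
  G.filter fun p => p.1.1 = v ∨ p.1.2 = v

theorem prod_pow_card_incidentEdges {n : ℕ} (G : Finset (UndirEdge n)) (x : Fin n → ℝ) :
    ∏ v, x v ^ (incidentEdges G v).card = ∏ p ∈ G, (x p.1.1 * x p.1.2) := by
  have h : ∀ v, x v ^ (incidentEdges G v).card =
      ∏ p ∈ G, if p.1.1 = v ∨ p.1.2 = v then x v else 1 := fun v => by
    rw [incidentEdges, ← Finset.prod_const, Finset.prod_filter]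
  simp_rw [h]
  rw [Finset.prod_comm]
  refine Finset.prod_congr rfl fun p _ => ?_
  have hne : p.1.1 ≠ p.1.2 := p.2.ne
  have : ∀ v, (if p.1.1 = v ∨ p.1.2 = v then x v else 1) =
      (if p.1.1 = v then x v else 1) * (if p.1.2 = v then x v else 1) := by
    intro v
    by_cases h1 : p.1.1 = v
    · have h2 : p.1.2 ≠ v := fun h2 => hne (h1.trans h2.symm)
      simp [h1, h2]
    · simp [h1]
  simp_rw [this]
  rw [Finset.prod_mul_distrib]
  simp

/-- A two-point distribution which is centred, although all of its moments of order other than one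
are at least one: the value `2` has probability `1 / 3`, the value `-1` has probability `2 / 3`. -/
noncomputable def twoPointWeight (b : Bool) : ℝ := if b then 1 / 3 else 2 / 3

/-- The values of the distribution given by `twoPointWeight`. -/
noncomputable def twoPointValue (b : Bool) : ℝ := if b then 2 else -1

theorem twoPointWeight_nonneg (b : Bool) : 0 ≤ twoPointWeight b := by
  cases b <;> norm_num [twoPointWeight]

/-- The moments of the two-point distribution detect that an exponent is not one. -/
theorem one_le_twoPoint_moment {d : ℕ} (hd : d ≠ 1) :
    1 ≤ ∑ b, twoPointWeight b * twoPointValue b ^ d := by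
  simp only [Fintype.sum_bool, twoPointWeight, twoPointValue, if_true, Bool.false_eq_true, if_false]
  rcases Nat.lt_or_ge d 2 with h | h
  · have : d = 0 := by omega
    subst this; norm_num
  obtain ⟨k, rfl⟩ := Nat.exists_eq_add_of_le h
  rcases Nat.even_or_odd (2 + k) with he | ho
  · have h2 : (1 : ℝ) ≤ 2 ^ (2 + k) := one_le_pow₀ (by norm_num)
    rw [he.neg_one_pow]; linarith
  · have hk : 1 ≤ k := by
      rcases Nat.eq_zero_or_pos k with h0 | h0
      · subst h0; exact absurd ho (by decide)
      · exact h0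
    have h2 : (2 : ℝ) ^ 3 ≤ 2 ^ (2 + k) := pow_le_pow_right₀ (by norm_num) (by omega)
    rw [ho.neg_one_pow]; linarith

theorem twoPoint_moment_nonneg (d : ℕ) :
    0 ≤ ∑ b, twoPointWeight b * twoPointValue b ^ d := by
  by_cases hd : d = 1
  · subst hd; norm_num [twoPointWeight, twoPointValue]
  · exact zero_le_one.trans (one_le_twoPoint_moment hd)

/-- The two-point distribution is subgaussian. -/
theorem twoPoint_mgf_le (t : ℝ) :
    ∑ b, twoPointWeight b * Real.exp (t * twoPointValue b) ≤ Real.exp (4 * t ^ 2) := by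
  simp only [Fintype.sum_bool, twoPointWeight, twoPointValue, if_true, Bool.false_eq_true, if_false]
  have h1 := Real.exp_le_add_exp_sq (t * 2)
  have h2 := Real.exp_le_add_exp_sq (t * -1)
  have h3 : Real.exp ((t * 2) ^ 2) = Real.exp (4 * t ^ 2) := by ring_nf
  have h4 : Real.exp ((t * -1) ^ 2) ≤ Real.exp (4 * t ^ 2) :=
    Real.exp_le_exp.2 (by nlinarith [sq_nonneg t])
  linarith

theorem integral_exp_sq_div_four_gaussianReal :
    Integrable (fun g : ℝ => Real.exp (g ^ 2 / 4)) (gaussianReal 0 1) ∧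
      ∫ g, Real.exp (g ^ 2 / 4) ∂(gaussianReal 0 1) = √2 := by
  have hpdf : ∀ g : ℝ, gaussianPDFReal 0 1 g • Real.exp (g ^ 2 / 4) =
      (√(2 * Real.pi))⁻¹ * Real.exp (-(1 / 4) * g ^ 2) := by
    intro g
    rw [gaussianPDFReal, smul_eq_mul, mul_assoc, ← Real.exp_add]
    congr 2
    · simp
    · simp; ring
  have hval : ∫ g, Real.exp (g ^ 2 / 4) ∂(gaussianReal 0 1) = √2 := by
    rw [integral_gaussianReal_eq_integral_smul (by norm_num)]
    simp_rw [hpdf]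
    rw [integral_const_mul, integral_gaussian, ← Real.sqrt_inv, ← Real.sqrt_mul (by positivity)]
    congr 1
    field_simp
    norm_num
  refine ⟨?_, hval⟩
  by_contra h
  rw [integral_undef h] at hval
  have : 0 < √(2 : ℝ) := by positivity
  linarith

/-- Gaussian linearization: exponential moments of the square of a sum of independent copies of the
two-point distribution are bounded. -/
theorem sum_twoPoint_exp_sq_le (n : ℕ) (z : ℝ) (hz0 : 0 ≤ z) (hz : 16 * n * z ≤ 1) :
    ∑ s : Fin n → Bool, (∏ v, twoPointWeight (s v)) *
      Real.exp (z * (∑ v, twoPointValue (s v)) ^ 2 / 2) ≤ √2 := by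
  have hlin : ∀ X : ℝ, Real.exp (z * X ^ 2 / 2) =
      ∫ g, Real.exp (√z * X * g) ∂(gaussianReal 0 1) := by
    intro X
    have := congrFun (mgf_id_gaussianReal (μ := 0) (v := 1)) (√z * X)
    simp only [mgf, id] at this
    rw [this, mul_pow, Real.sq_sqrt hz0]
    simp
  have hint : ∀ X : ℝ, Integrable (fun g => Real.exp (√z * X * g)) (gaussianReal 0 1) :=
    fun X => integrable_exp_mul_gaussianReal _
  simp_rw [hlin, ← integral_const_mul]
  rw [← integral_finsetSum _ fun s _ => (hint _).const_mul _,
    ← integral_exp_sq_div_four_gaussianReal.2]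
  refine integral_mono (integrable_finsetSum _ fun s _ => (hint _).const_mul _)
    integral_exp_sq_div_four_gaussianReal.1 fun g => ?_
  have hprod : ∀ s : Fin n → Bool, (∏ v, twoPointWeight (s v)) *
      Real.exp (√z * (∑ v, twoPointValue (s v)) * g) =
      ∏ v, twoPointWeight (s v) * Real.exp (√z * g * twoPointValue (s v)) := by
    intro s
    rw [Finset.prod_mul_distrib, ← Real.exp_sum, ← Finset.mul_sum]
    congr 2; ring
  simp_rw [hprod]
  have := Finset.prod_univ_sum (fun _ : Fin n => (Finset.univ : Finset Bool))
    (fun _ b => twoPointWeight b * Real.exp (√z * g * twoPointValue b))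
  rw [Fintype.piFinset_univ] at this
  rw [← this, Finset.prod_const, Finset.card_univ, Fintype.card_fin]
  calc _ ≤ Real.exp (4 * (√z * g) ^ 2) ^ n :=
        pow_le_pow_left₀ (Finset.sum_nonneg fun b _ => mul_nonneg (twoPointWeight_nonneg b)
          (Real.exp_pos _).le) (twoPoint_mgf_le _) n
    _ = Real.exp (16 * n * z * (g ^ 2 / 4)) := by
        rw [← Real.exp_nat_mul, mul_pow, Real.sq_sqrt hz0]; congr 1; ring
    _ ≤ Real.exp (g ^ 2 / 4) := Real.exp_le_exp.2 (by nlinarith [sq_nonneg g])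

theorem sum_undirEdge_mul_le {n : ℕ} (x : Fin n → ℝ) :
    ∑ p : UndirEdge n, x p.1.1 * x p.1.2 ≤ (∑ v, x v) ^ 2 / 2 := by
  have h1 : ∑ p : UndirEdge n, x p.1.1 * x p.1.2 =
      ∑ p : Fin n × Fin n with p.1 < p.2, x p.1 * x p.2 :=
    Finset.sum_subtype_eq_sum_filter (s := Finset.univ) (p := fun p : Fin n × Fin n => p.1 < p.2)
      (fun p => x p.1 * x p.2) |>.symm ▸ by simp
  have h2 : ∑ p : Fin n × Fin n with p.1 < p.2, x p.1 * x p.2 =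
      ∑ p : Fin n × Fin n with p.2 < p.1, x p.1 * x p.2 :=
    Finset.sum_bij' (fun p _ => p.swap) (fun p _ => p.swap) (by simp) (by simp) (by simp) (by simp)
      (by intro p _; simp [mul_comm])
  have h3 : (∑ v, x v) ^ 2 = ∑ p : Fin n × Fin n, x p.1 * x p.2 := by
    rw [sq, Finset.sum_mul_sum, Fintype.sum_prod_type]
  have h4 : ∑ p : Fin n × Fin n, x p.1 * x p.2 =
      ∑ p : Fin n × Fin n with p.1 < p.2, x p.1 * x p.2 +
      ∑ p : Fin n × Fin n with ¬ p.1 < p.2, x p.1 * x p.2 :=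
    (Finset.sum_filter_add_sum_filter_not _ _ _).symm
  have h5 : ∑ p : Fin n × Fin n with p.2 < p.1, x p.1 * x p.2 ≤
      ∑ p : Fin n × Fin n with ¬ p.1 < p.2, x p.1 * x p.2 := by
    refine Finset.sum_le_sum_of_subset_of_nonneg ?_ ?_
    · intro p; simpa using le_of_lt
    · intro p hp hp'
      simp only [Finset.mem_filter, Finset.mem_univ, true_and, not_lt] at hp hp'
      rw [le_antisymm hp hp']
      exact mul_self_nonneg _
  linarith

/-- The graphs without vertices of degree one, weighted by `z` to the number of edges, have bounded
total weight as long as `z` is at most a small multiple of `1 / n`. -/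
theorem sum_graph_card_incidentEdges_ne_one_le (n : ℕ) (z : ℝ) (hz0 : 0 ≤ z) (hz1 : 2 * z ≤ 1)
    (hz : 16 * n * z ≤ 1) :
    ∑ G : Finset (UndirEdge n), (if ∀ v, (incidentEdges G v).card ≠ 1 then z ^ G.card else 0) ≤
      √2 := by
  refine le_trans ?_ (sum_twoPoint_exp_sq_le n z hz0 hz)
  calc _ ≤ ∑ G : Finset (UndirEdge n), z ^ G.card *
        ∏ v, ∑ b, twoPointWeight b * twoPointValue b ^ (incidentEdges G v).card := by
        refine Finset.sum_le_sum fun G _ => ?_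
        split_ifs with h
        · refine le_mul_of_one_le_right (by positivity) ?_
          calc (1 : ℝ) = ∏ _v : Fin n, 1 := by simp
            _ ≤ _ := Finset.prod_le_prod (fun _ _ => zero_le_one)
              fun v _ => one_le_twoPoint_moment (h v)
        · exact mul_nonneg (by positivity)
            (Finset.prod_nonneg fun v _ => twoPoint_moment_nonneg _)
    _ = ∑ s : Fin n → Bool, (∏ v, twoPointWeight (s v)) *
          ∏ p : UndirEdge n, (1 + z * (twoPointValue (s p.1.1) * twoPointValue (s p.1.2))) := by
        have : ∀ G : Finset (UndirEdge n), z ^ G.card *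
            ∏ v, ∑ b, twoPointWeight b * twoPointValue b ^ (incidentEdges G v).card =
            ∑ s : Fin n → Bool, (∏ v, twoPointWeight (s v)) *
              ∏ p ∈ G, z * (twoPointValue (s p.1.1) * twoPointValue (s p.1.2)) := by
          intro G
          rw [Finset.prod_univ_sum, Fintype.piFinset_univ, Finset.mul_sum]
          refine Finset.sum_congr rfl fun s _ => ?_
          rw [Finset.prod_mul_distrib,
            prod_pow_card_incidentEdges G (fun v => twoPointValue (s v)),
            Finset.prod_mul_distrib (f := fun _ => z), Finset.prod_const]
          ring
        simp_rw [this]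
        rw [Finset.sum_comm]
        refine Finset.sum_congr rfl fun s _ => ?_
        rw [Finset.prod_one_add, Finset.mul_sum, Finset.powerset_univ]
    _ ≤ _ := by
        refine Finset.sum_le_sum fun s _ => mul_le_mul_of_nonneg_left ?_
          (Finset.prod_nonneg fun v _ => twoPointWeight_nonneg _)
        have hval : ∀ a b : Bool, -2 ≤ twoPointValue a * twoPointValue b := by
          intro a b; cases a <;> cases b <;> norm_num [twoPointValue]
        calc _ ≤ ∏ p : UndirEdge n,
              Real.exp (z * (twoPointValue (s p.1.1) * twoPointValue (s p.1.2))) := by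
              refine Finset.prod_le_prod (fun p _ => ?_) fun p _ => ?_
              · nlinarith [hval (s p.1.1) (s p.1.2)]
              · linarith [Real.add_one_le_exp
                  (z * (twoPointValue (s p.1.1) * twoPointValue (s p.1.2)))]
          _ ≤ _ := by
              rw [← Real.exp_sum, ← Finset.mul_sum, Real.exp_le_exp, mul_div_assoc]
              exact mul_le_mul_of_nonneg_left
                (sum_undirEdge_mul_le fun v => twoPointValue (s v)) hz0

/-! ### Mixed moments of the entries -/

/-- The orientation of an undirected edge from its smaller to its larger endpoint. -/
def UndirEdge.fwd {n : ℕ} (p : UndirEdge n) : DirEdge n := ⟨p.1, p.2.ne⟩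

/-- The orientation of an undirected edge from its larger to its smaller endpoint. -/
def UndirEdge.bwd {n : ℕ} (p : UndirEdge n) : DirEdge n := p.fwd.rev

theorem DirEdge.exists_eq_fwd_or_eq_bwd {n : ℕ} (f : DirEdge n) :
    ∃ p : UndirEdge n, f = p.fwd ∨ f = p.bwd := by
  rcases lt_or_gt_of_ne f.2 with h | h
  · exact ⟨⟨f.1, h⟩, Or.inl rfl⟩
  · exact ⟨⟨(f.1.2, f.1.1), h⟩, Or.inr rfl⟩

theorem prod_dirEdge {n : ℕ} {β : Type*} [CommMonoid β] (h : DirEdge n → β) :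
    ∏ f, h f = ∏ p : UndirEdge n, h p.fwd * h p.bwd := by
  rw [Finset.prod_mul_distrib]
  have := Fintype.prod_sum_type
    (fun x : UndirEdge n ⊕ UndirEdge n => h (Sum.elim UndirEdge.fwd UndirEdge.bwd x))
  simp only [Sum.elim_inl, Sum.elim_inr] at this
  rw [← this]
  symm
  refine Fintype.prod_bijective (Sum.elim UndirEdge.fwd UndirEdge.bwd) ⟨?_, ?_⟩ _ _ fun _ => rfl
  · rintro (p | p) (q | q) hpq <;>
      simp only [Sum.elim_inl, Sum.elim_inr, UndirEdge.fwd, UndirEdge.bwd, DirEdge.rev,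
        Subtype.mk.injEq, Prod.ext_iff] at hpq
    · congr 1; exact Subtype.ext (Prod.ext hpq.1 hpq.2)
    · have h1 := p.2; have h2 := q.2
      rw [hpq.1, hpq.2] at h1; exact absurd h1 h2.asymm
    · have h1 := p.2; have h2 := q.2
      rw [hpq.1, hpq.2] at h1; exact absurd h1 h2.asymm
    · congr 1; exact Subtype.ext (Prod.ext hpq.2 hpq.1)
  · intro f
    obtain ⟨p, h | h⟩ := f.exists_eq_fwd_or_eq_bwd
    · exact ⟨Sum.inl p, h.symm⟩
    · exact ⟨Sum.inr p, h.symm⟩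

/-- The exponent of the entry `M p` (as opposed to its complex conjugate) in the product of the
entries of a Hermitian matrix `M` over `S` and of the conjugates of its entries over `T`. By
symmetry the exponent of the conjugate is `edgeExponent T S p`. -/
def edgeExponent {n : ℕ} (S T : Finset (DirEdge n)) (p : UndirEdge n) : ℕ :=
  (if p.fwd ∈ S then 1 else 0) + (if p.bwd ∈ T then 1 else 0)

theorem edgeExponent_le_two {n : ℕ} (S T : Finset (DirEdge n)) (p : UndirEdge n) :
    edgeExponent S T p ≤ 2 := by
  unfold edgeExponent; split_ifs <;> simp

theorem sum_edgeExponent {n : ℕ} (S T : Finset (DirEdge n)) :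
    ∑ p, (edgeExponent S T p + edgeExponent T S p) = S.card + T.card := by
  have h : ∀ S : Finset (DirEdge n), S.card =
      ∑ p : UndirEdge n, ((if p.fwd ∈ S then 1 else 0) + (if p.bwd ∈ S then 1 else 0)) := by
    intro S
    have := prod_dirEdge (β := Multiplicative ℕ)
      (fun f => Multiplicative.ofAdd (if f ∈ S then 1 else 0))
    have h2 : ∑ f, (if f ∈ S then 1 else 0) =
      ∑ p : UndirEdge n, ((if p.fwd ∈ S then 1 else 0) + (if p.bwd ∈ S then 1 else 0)) := this
    rw [← h2]; simp
  rw [h S, h T, ← Finset.sum_add_distrib]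
  refine Finset.sum_congr rfl fun p _ => ?_
  unfold edgeExponent
  ring

theorem Matrix.IsHermitian.prod_mul_conj_prod_eq {n : ℕ} {M : Matrix (Fin n) (Fin n) ℂ}
    (hM : M.IsHermitian) (S T : Finset (DirEdge n)) :
    (∏ f ∈ S, M f.1.1 f.1.2) * (starRingEnd ℂ) (∏ f ∈ T, M f.1.1 f.1.2) =
      ∏ p : UndirEdge n, M p.1.1 p.1.2 ^ edgeExponent S T p *
        (starRingEnd ℂ) (M p.1.1 p.1.2) ^ edgeExponent T S p := by
  have h : ∀ S : Finset (DirEdge n), ∏ f ∈ S, M f.1.1 f.1.2 =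
      ∏ p : UndirEdge n, (if p.fwd ∈ S then M p.1.1 p.1.2 else 1) *
        (if p.bwd ∈ S then (starRingEnd ℂ) (M p.1.1 p.1.2) else 1) := by
    intro S
    have h1 : ∏ f ∈ S, M f.1.1 f.1.2 = ∏ f, if f ∈ S then M f.1.1 f.1.2 else 1 := by
      rw [Finset.prod_ite_mem, Finset.univ_inter]
    rw [h1, prod_dirEdge]
    refine Finset.prod_congr rfl fun p _ => ?_
    have : M p.1.2 p.1.1 = (starRingEnd ℂ) (M p.1.1 p.1.2) := (hM.apply _ _).symm
    rw [← this]
    rfl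
  rw [h S, h T, map_prod, ← Finset.prod_mul_distrib]
  refine Finset.prod_congr rfl fun p _ => ?_
  unfold edgeExponent
  by_cases h1 : p.fwd ∈ S <;> by_cases h2 : p.bwd ∈ S <;> by_cases h3 : p.fwd ∈ T <;>
    by_cases h4 : p.bwd ∈ T <;> simp [h1, h2, h3, h4] <;> ring

section Moments

variable {Ω : Type u} [MeasurableSpace Ω] {P : Measure Ω} [IsProbabilityMeasure P]

theorem integrable_norm_pow_of_le_four {X : Ω → ℂ} (hX : Measurable X)
    (h4 : Integrable (fun ω => ‖X ω‖ ^ 4) P) {k : ℕ} (hk : k ≤ 4) :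
    Integrable (fun ω => ‖X ω‖ ^ k) P := by
  refine Integrable.mono' ((integrable_const (1 : ℝ)).add h4) (hX.norm.pow_const k).aestronglyMeasurable
    (Filter.Eventually.of_forall fun ω => ?_)
  rw [Real.norm_of_nonneg (by positivity), Pi.add_apply]
  rcases le_total ‖X ω‖ 1 with h | h
  · have := pow_le_one₀ (n := k) (norm_nonneg (X ω)) h
    have : 0 ≤ ‖X ω‖ ^ 4 := by positivity
    linarith
  · have := pow_le_pow_right₀ h hk
    linarith

theorem norm_pow_mul_conj_pow (x : ℂ) (a b : ℕ) :
    ‖x ^ a * (starRingEnd ℂ) x ^ b‖ = ‖x‖ ^ (a + b) := by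
  rw [norm_mul, norm_pow, norm_pow, RCLike.norm_conj, pow_add]

theorem integrable_pow_mul_conj_pow {X : Ω → ℂ} (hX : Measurable X)
    (h4 : Integrable (fun ω => ‖X ω‖ ^ 4) P) {a b : ℕ} (hab : a + b ≤ 4) :
    Integrable (fun ω => X ω ^ a * (starRingEnd ℂ) (X ω) ^ b) P := by
  refine Integrable.mono' (integrable_norm_pow_of_le_four hX h4 hab)
    ((hX.pow_const a).mul ((Complex.continuous_conj.measurable.comp hX).pow_const
      b)).aestronglyMeasurable (Filter.Eventually.of_forall fun ω => ?_)
  rw [norm_pow_mul_conj_pow]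

/-- The mixed moments of orders two to four are controlled by the absolute moments of orders two
and four, the moments of order one vanish. -/
theorem pow_mul_norm_integral_pow_mul_conj_pow_le {X : Ω → ℂ} (hX : Measurable X)
    (h4 : Integrable (fun ω => ‖X ω‖ ^ 4) P) (hmean : ∫ ω, X ω ∂P = 0) {q : ℝ}
    (hq2 : ∫ ω, ‖X ω‖ ^ 2 ∂P ≤ q) (hq4 : ∫ ω, ‖X ω‖ ^ 4 ∂P ≤ q) {ρ : ℝ} (hρ0 : 0 ≤ ρ)
    (hρ1 : ρ ≤ 1) {a b : ℕ} (hab : a + b ≤ 4) :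
    ρ ^ (a + b) * ‖∫ ω, X ω ^ a * (starRingEnd ℂ) (X ω) ^ b ∂P‖ ≤
      if a + b = 0 then 1 else ρ ^ 2 * q := by
  have hq0 : 0 ≤ q := le_trans (integral_nonneg fun ω => by positivity) hq2
  rcases Nat.lt_or_ge (a + b) 2 with h | h
  · rcases Nat.eq_zero_or_pos (a + b) with h0 | h0
    · obtain ⟨rfl, rfl⟩ : a = 0 ∧ b = 0 := by omega
      simp
    · have hz : ∫ ω, X ω ^ a * (starRingEnd ℂ) (X ω) ^ b ∂P = 0 := by
        have : (a = 1 ∧ b = 0) ∨ (a = 0 ∧ b = 1) := by omega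
        rcases this with ⟨rfl, rfl⟩ | ⟨rfl, rfl⟩
        · simpa using hmean
        · simp [integral_conj, hmean]
      rw [hz, norm_zero, mul_zero, if_neg h0.ne']
      positivity
  · rw [if_neg (by omega)]
    have hρ : ρ ^ (a + b) ≤ ρ ^ 2 := pow_le_pow_of_le_one hρ0 hρ1 h
    refine mul_le_mul hρ ?_ (norm_nonneg _) (by positivity)
    refine (norm_integral_le_integral_norm _).trans ?_
    simp_rw [norm_pow_mul_conj_pow]
    have i2 := integrable_norm_pow_of_le_four hX h4 (show 2 ≤ 4 by norm_num)
    generalize a + b = k at h hab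
    interval_cases k
    · exact hq2
    · calc ∫ ω, ‖X ω‖ ^ 3 ∂P ≤ ∫ ω, (‖X ω‖ ^ 2 + ‖X ω‖ ^ 4) / 2 ∂P := by
            refine integral_mono (integrable_norm_pow_of_le_four hX h4 (by norm_num))
              ((i2.add h4).div_const 2) fun ω => ?_
            have : 0 ≤ (‖X ω‖ * (‖X ω‖ - 1)) ^ 2 := sq_nonneg _
            simp only
            nlinarith
        _ ≤ q := by
            rw [integral_div, integral_add i2 h4]; linarith
    · exact hq4

variable {n : ℕ} {M : Ω → Matrix (Fin n) (Fin n) ℂ}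

theorem IsNonasymptoticWigner.integrable_prod_mul_conj_prod (hM : IsNonasymptoticWigner P M)
    (S T : Finset (DirEdge n)) :
    Integrable (fun ω => (∏ f ∈ S, M ω f.1.1 f.1.2) *
      (starRingEnd ℂ) (∏ f ∈ T, M ω f.1.1 f.1.2)) P := by
  simp_rw [(hM.isHermitian _).prod_mul_conj_prod_eq]
  let g : UndirEdge n → ℂ → ℂ := fun p x =>
    x ^ edgeExponent S T p * (starRingEnd ℂ) x ^ edgeExponent T S p
  have hg : ∀ p, Measurable (g p) := fun p =>
    (measurable_id.pow_const _).mul (Complex.continuous_conj.measurable.pow_const _)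
  have hmeas : Measurable fun ω => fun p : UndirEdge n => M ω p.1.1 p.1.2 :=
    measurable_pi_lambda _ fun p => hM.measurable_entry _ _
  have hpi := hM.indep.map_fun_eq_pi_map fun p : UndirEdge n => (hM.measurable_entry p.1.1 p.1.2).aemeasurable
  have hint : Integrable (fun x : UndirEdge n → ℂ => ∏ p, g p (x p))
      (P.map fun ω => fun p : UndirEdge n => M ω p.1.1 p.1.2) := by
    rw [hpi]
    have : ∀ p : UndirEdge n, IsProbabilityMeasure (P.map fun ω => M ω p.1.1 p.1.2) := fun p =>
      Measure.isProbabilityMeasure_map (hM.measurable_entry _ _).aemeasurable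
    refine Integrable.fintype_prod fun p => ?_
    rw [integrable_map_measure (hg p).aestronglyMeasurable (hM.measurable_entry _ _).aemeasurable]
    refine integrable_pow_mul_conj_pow (hM.measurable_entry _ _) (hM.integrable_fourth _ _ p.2) ?_
    have := edgeExponent_le_two S T p
    have := edgeExponent_le_two T S p
    omega
  exact hint.comp_measurable hmeas

/-- By independence the expectation factorizes over the undirected edges. The power of `ρ` is kept on
the left because an edge of the support, used at least twice, turns it into `ρ ^ 2`. -/
theorem IsNonasymptoticWigner.pow_mul_norm_integral_prod_mul_conj_prod_le
    (hM : IsNonasymptoticWigner P M) (S T : Finset (DirEdge n)) {ρ : ℝ} (hρ0 : 0 ≤ ρ)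
    (hρ1 : ρ ≤ 1) :
    ρ ^ (S.card + T.card) * ‖∫ ω, (∏ f ∈ S, M ω f.1.1 f.1.2) *
      (starRingEnd ℂ) (∏ f ∈ T, M ω f.1.1 f.1.2) ∂P‖ ≤
      ∏ p : UndirEdge n,
        if edgeExponent S T p + edgeExponent T S p = 0 then 1 else ρ ^ 2 * (1 / (n : ℝ)) := by
  simp_rw [(hM.isHermitian _).prod_mul_conj_prod_eq]
  have hg : ∀ p, Measurable fun x : ℂ =>
      x ^ edgeExponent S T p * (starRingEnd ℂ) x ^ edgeExponent T S p := fun p =>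
    (measurable_id.pow_const _).mul (Complex.continuous_conj.measurable.pow_const _)
  rw [hM.indep.integral_fun_prod_comp (f := fun p x =>
    x ^ edgeExponent S T p * (starRingEnd ℂ) x ^ edgeExponent T S p)
    (fun p => (hM.measurable_entry _ _).aemeasurable) fun p => (hg p).aestronglyMeasurable,
    norm_prod, ← sum_edgeExponent, ← Finset.prod_pow_eq_pow_sum, ← Finset.prod_mul_distrib]
  refine Finset.prod_le_prod (fun p _ => by positivity) fun p _ => ?_
  refine pow_mul_norm_integral_pow_mul_conj_pow_le (hM.measurable_entry _ _)
    (hM.integrable_fourth _ _ p.2) (hM.mean_eq_zero _ _ p.2) (hM.second_moment _ _ p.2).le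
    (hM.fourth_moment _ _ p.2) hρ0 hρ1 ?_
  have := edgeExponent_le_two S T p
  have := edgeExponent_le_two T S p
  omega

end Moments

/-! ### The expected square norm of the coefficients -/

/-- The undirected edges underlying `S ∪ T`. -/
def edgeSupport {n : ℕ} (S T : Finset (DirEdge n)) : Finset (UndirEdge n) :=
  Finset.univ.filter fun p => edgeExponent S T p + edgeExponent T S p ≠ 0

theorem mem_edgeSupport {n : ℕ} {S T : Finset (DirEdge n)} {p : UndirEdge n} :
    p ∈ edgeSupport S T ↔ (p.fwd ∈ S ∨ p.bwd ∈ S) ∨ p.fwd ∈ T ∨ p.bwd ∈ T := by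
  simp only [edgeSupport, edgeExponent]
  by_cases h1 : p.fwd ∈ S <;> by_cases h2 : p.bwd ∈ S <;> by_cases h3 : p.fwd ∈ T <;>
    by_cases h4 : p.bwd ∈ T <;> simp [h1, h2, h3, h4]

theorem nbMinor_eq_zero_of_unique_undirEdge {n : ℕ} (S : Finset (DirEdge n)) (v : Fin n)
    (p : UndirEdge n) (hpv : p.1.1 = v ∨ p.1.2 = v) (hp : p.fwd ∈ S ∨ p.bwd ∈ S)
    (h : ∀ q : UndirEdge n, q.1.1 = v ∨ q.1.2 = v → q.fwd ∈ S ∨ q.bwd ∈ S → q = p) :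
    nbMinor S = 0 := by
  have hf : ∀ f ∈ S, f.1.1 = v ∨ f.1.2 = v → f = p.fwd ∨ f = p.bwd := by
    intro f hf hfv
    obtain ⟨q, hq | hq⟩ := f.exists_eq_fwd_or_eq_bwd
    · rw [hq] at hf hfv
      rw [← h q hfv (Or.inl hf)]; exact Or.inl hq
    · rw [hq] at hf hfv
      rw [← h q hfv.symm (Or.inr hf)]; exact Or.inr hq
  rcases hp with hp | hp
  · exact nbMinor_eq_zero S p.fwd hp v hpv hf
  · exact nbMinor_eq_zero S p.bwd hp v hpv.symm fun f h1 h2 => (hf f h1 h2).symm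

theorem nbMinor_eq_zero_or_of_card_incidentEdges_eq_one {n : ℕ} (S T : Finset (DirEdge n))
    (v : Fin n) (h : (incidentEdges (edgeSupport S T) v).card = 1) :
    nbMinor S = 0 ∨ nbMinor T = 0 := by
  obtain ⟨p, hp⟩ := Finset.card_eq_one.1 h
  have hmem : ∀ q, (q ∈ edgeSupport S T ∧ (q.1.1 = v ∨ q.1.2 = v)) ↔ q = p := by
    intro q
    rw [← Finset.mem_singleton (a := p), ← hp, incidentEdges, Finset.mem_filter]
  obtain ⟨h1, h2⟩ := (hmem p).2 rfl
  rcases mem_edgeSupport.1 h1 with h1 | h1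
  · exact Or.inl (nbMinor_eq_zero_of_unique_undirEdge S v p h2 h1 fun q hq hqS =>
      (hmem q).1 ⟨mem_edgeSupport.2 (Or.inl hqS), hq⟩)
  · exact Or.inr (nbMinor_eq_zero_of_unique_undirEdge T v p h2 h1 fun q hq hqT =>
      (hmem q).1 ⟨mem_edgeSupport.2 (Or.inr hqT), hq⟩)

/-- At most `16 ^ |G|` pairs of sets of directed edges have a given underlying graph `G`. -/
theorem sum_edgeSupport_le {n : ℕ} (F : Finset (UndirEdge n) → ℝ) (hF : ∀ G, 0 ≤ F G) :
    ∑ S : Finset (DirEdge n), ∑ T : Finset (DirEdge n), F (edgeSupport S T) ≤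
      ∑ G, 16 ^ G.card * F G := by
  rw [← Fintype.sum_prod_type' (f := fun S T : Finset (DirEdge n) => F (edgeSupport S T)),
    ← Finset.sum_fiberwise (s := Finset.univ)
      (g := fun x : Finset (DirEdge n) × Finset (DirEdge n) => edgeSupport x.1 x.2)]
  refine Finset.sum_le_sum fun G _ => ?_
  rw [Finset.sum_congr rfl (g := fun _ => F G) (fun x hx => by
    rw [(Finset.mem_filter.1 hx).2]), Finset.sum_const, nsmul_eq_mul]
  refine mul_le_mul_of_nonneg_right ?_ (hF G)
  let D : Finset (DirEdge n) := G.image UndirEdge.fwd ∪ G.image UndirEdge.bwd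
  have hD : D.card ≤ 2 * G.card := by
    refine (Finset.card_union_le _ _).trans ?_
    have h1 := Finset.card_image_le (s := G) (f := UndirEdge.fwd)
    have h2 := Finset.card_image_le (s := G) (f := UndirEdge.bwd)
    omega
  have hsub : (Finset.univ.filter fun x : Finset (DirEdge n) × Finset (DirEdge n) =>
      edgeSupport x.1 x.2 = G) ⊆ D.powerset ×ˢ D.powerset := by
    rintro ⟨S, T⟩ hx
    have hG : edgeSupport S T = G := (Finset.mem_filter.1 hx).2
    have hmemD : ∀ p : UndirEdge n, p ∈ edgeSupport S T → p.fwd ∈ D ∧ p.bwd ∈ D := by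
      intro p hp
      rw [hG] at hp
      exact ⟨Finset.mem_union_left _ (Finset.mem_image_of_mem _ hp),
        Finset.mem_union_right _ (Finset.mem_image_of_mem _ hp)⟩
    simp only [Finset.mem_product, Finset.mem_powerset]
    constructor
    · intro f hf
      obtain ⟨p, rfl | rfl⟩ := f.exists_eq_fwd_or_eq_bwd
      · exact (hmemD p (mem_edgeSupport.2 (by tauto))).1
      · exact (hmemD p (mem_edgeSupport.2 (by tauto))).2
    · intro f hf
      obtain ⟨p, rfl | rfl⟩ := f.exists_eq_fwd_or_eq_bwd
      · exact (hmemD p (mem_edgeSupport.2 (by tauto))).1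
      · exact (hmemD p (mem_edgeSupport.2 (by tauto))).2
  have hcard : (Finset.univ.filter fun x : Finset (DirEdge n) × Finset (DirEdge n) =>
      edgeSupport x.1 x.2 = G).card ≤ 16 ^ G.card := by
    refine (Finset.card_le_card hsub).trans ?_
    rw [Finset.card_product, Finset.card_powerset, ← pow_add]
    calc 2 ^ (D.card + D.card) ≤ 2 ^ (4 * G.card) := Nat.pow_le_pow_right (by norm_num) (by omega)
      _ = 16 ^ G.card := by rw [pow_mul]; norm_num
  exact_mod_cast hcard

/-- The weighted square sum of the coefficients of `det (1 + X B)`, for the nonbacktracking matrix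
`B` of `M`, with the weight `r ^ (2 k)` on the `k`-th coefficient for the radius `r = 1 / 64`. It is
the mean square of that polynomial on the circle of radius `r`. The radius compensates the growth of
the minors by a factor `4` per directed edge, the `16` ways to use an undirected edge in a pair of
edge sets, and leaves the weight `1 / (16 n)` per undirected edge. -/
noncomputable def coeffEnergy {n : ℕ} (M : Matrix (Fin n) (Fin n) ℂ) : ℝ :=
  ∑ k ∈ Finset.range (Fintype.card (DirEdge n) + 1),
    (1 / 64 : ℝ) ^ (2 * k) * ‖sumPrincipalMinors (nonbacktrackingMatrix M) k‖ ^ 2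

theorem coeffEnergy_nonneg {n : ℕ} (M : Matrix (Fin n) (Fin n) ℂ) : 0 ≤ coeffEnergy M :=
  Finset.sum_nonneg fun _ _ => by positivity

theorem sumPrincipalMinors_nonbacktrackingMatrix {n : ℕ} (M : Matrix (Fin n) (Fin n) ℂ) (k : ℕ) :
    sumPrincipalMinors (nonbacktrackingMatrix M) k =
      ∑ S ∈ Finset.univ.powersetCard k, nbMinor S * ∏ f ∈ S, M f.1.1 f.1.2 :=
  Finset.sum_congr rfl fun S _ => det_submatrix_nonbacktrackingMatrix M S

section Energy

variable {Ω : Type u} [MeasurableSpace Ω] {P : Measure Ω} [IsProbabilityMeasure P] {n : ℕ}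
  {M : Ω → Matrix (Fin n) (Fin n) ℂ}

theorem IsNonasymptoticWigner.pow_mul_norm_nbMinor_mul_le (hM : IsNonasymptoticWigner P M)
    (S T : Finset (DirEdge n)) :
    (1 / 64 : ℝ) ^ (S.card + T.card) * (‖nbMinor S‖ * ‖nbMinor T‖ *
      ‖∫ ω, (∏ f ∈ S, M ω f.1.1 f.1.2) *
        (starRingEnd ℂ) (∏ f ∈ T, M ω f.1.1 f.1.2) ∂P‖) ≤
      if ∀ v, (incidentEdges (edgeSupport S T) v).card ≠ 1 then
        ((1 / 16 : ℝ) ^ 2 * (1 / (n : ℝ))) ^ (edgeSupport S T).card else 0 := by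
  split_ifs with h
  · have h1 := hM.pow_mul_norm_integral_prod_mul_conj_prod_le S T (ρ := 1 / 16) (by norm_num)
      (by norm_num)
    rw [Finset.prod_ite, Finset.prod_const_one, one_mul, Finset.prod_const] at h1
    refine le_trans ?_ h1
    rw [← mul_assoc]
    refine mul_le_mul_of_nonneg_right ?_ (norm_nonneg _)
    calc (1 / 64 : ℝ) ^ (S.card + T.card) * (‖nbMinor S‖ * ‖nbMinor T‖)
        ≤ (1 / 64 : ℝ) ^ (S.card + T.card) * (4 ^ S.card * 4 ^ T.card) := by
          refine mul_le_mul_of_nonneg_left ?_ (by positivity)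
          exact mul_le_mul (norm_nbMinor_le S) (norm_nbMinor_le T) (norm_nonneg _) (by positivity)
      _ = (1 / 16 : ℝ) ^ (S.card + T.card) := by
          rw [← pow_add, ← mul_pow]; norm_num
  · push Not at h
    obtain ⟨v, hv⟩ := h
    rcases nbMinor_eq_zero_or_of_card_incidentEdges_eq_one S T v hv with h0 | h0 <;> simp [h0]

theorem IsNonasymptoticWigner.integral_norm_sq_sumPrincipalMinors_le
    (hM : IsNonasymptoticWigner P M) (k : ℕ) :
    Integrable (fun ω => ‖sumPrincipalMinors (nonbacktrackingMatrix (M ω)) k‖ ^ 2) P ∧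
    ∫ ω, ‖sumPrincipalMinors (nonbacktrackingMatrix (M ω)) k‖ ^ 2 ∂P ≤
      ∑ S ∈ Finset.univ.powersetCard k, ∑ T ∈ Finset.univ.powersetCard k,
        ‖nbMinor S‖ * ‖nbMinor T‖ * ‖∫ ω, (∏ f ∈ S, M ω f.1.1 f.1.2) *
          (starRingEnd ℂ) (∏ f ∈ T, M ω f.1.1 f.1.2) ∂P‖ := by
  have hexp : ∀ ω, ((‖sumPrincipalMinors (nonbacktrackingMatrix (M ω)) k‖ ^ 2 : ℝ) : ℂ) =
      ∑ S ∈ Finset.univ.powersetCard k, ∑ T ∈ Finset.univ.powersetCard k,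
        nbMinor S * (starRingEnd ℂ) (nbMinor T) * ((∏ f ∈ S, M ω f.1.1 f.1.2) *
          (starRingEnd ℂ) (∏ f ∈ T, M ω f.1.1 f.1.2)) := by
    intro ω
    rw [Complex.ofReal_pow, ← Complex.mul_conj', sumPrincipalMinors_nonbacktrackingMatrix, map_sum,
      Finset.sum_mul_sum]
    refine Finset.sum_congr rfl fun S _ => Finset.sum_congr rfl fun T _ => ?_
    rw [map_mul]; ring
  have hterm : ∀ S T : Finset (DirEdge n), Integrable (fun ω =>
      nbMinor S * (starRingEnd ℂ) (nbMinor T) * ((∏ f ∈ S, M ω f.1.1 f.1.2) *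
          (starRingEnd ℂ) (∏ f ∈ T, M ω f.1.1 f.1.2))) P := fun S T =>
    (hM.integrable_prod_mul_conj_prod S T).const_mul _
  have hint : Integrable (fun ω =>
      ((‖sumPrincipalMinors (nonbacktrackingMatrix (M ω)) k‖ ^ 2 : ℝ) : ℂ)) P := by
    simp_rw [hexp]
    exact integrable_finsetSum _ fun S _ => integrable_finsetSum _ fun T _ => hterm S T
  refine ⟨by simpa only [RCLike.re_to_complex, Complex.ofReal_re] using hint.re, ?_⟩
  have h1 : ∫ ω, ‖sumPrincipalMinors (nonbacktrackingMatrix (M ω)) k‖ ^ 2 ∂P ≤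
      ‖∫ ω, ((‖sumPrincipalMinors (nonbacktrackingMatrix (M ω)) k‖ ^ 2 : ℝ) : ℂ) ∂P‖ := by
    rw [integral_complex_ofReal, Complex.norm_real]
    exact le_abs_self _
  refine h1.trans ?_
  simp_rw [hexp]
  rw [integral_finsetSum _ fun S _ => integrable_finsetSum _ fun T _ => hterm S T]
  refine (norm_sum_le _ _).trans (Finset.sum_le_sum fun S _ => ?_)
  rw [integral_finsetSum _ fun T _ => hterm S T]
  refine (norm_sum_le _ _).trans (Finset.sum_le_sum fun T _ => ?_)
  rw [integral_const_mul, norm_mul, norm_mul, RCLike.norm_conj]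

theorem IsNonasymptoticWigner.integrable_coeffEnergy (hM : IsNonasymptoticWigner P M) :
    Integrable (fun ω => coeffEnergy (M ω)) P :=
  integrable_finsetSum _ fun k _ =>
    (hM.integral_norm_sq_sumPrincipalMinors_le k).1.const_mul _

/-- Only second and fourth moments enter the second moment of a coefficient, and the pairs of edge
sets that contribute span graphs without vertices of degree one. -/
theorem IsNonasymptoticWigner.integral_coeffEnergy_le (hM : IsNonasymptoticWigner P M) :
    ∫ ω, coeffEnergy (M ω) ∂P ≤ 2 := by
  set E : Finset (DirEdge n) → Finset (DirEdge n) → ℝ := fun S T =>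
    if ∀ v, (incidentEdges (edgeSupport S T) v).card ≠ 1 then
        ((1 / 16 : ℝ) ^ 2 * (1 / (n : ℝ))) ^ (edgeSupport S T).card else 0 with hE
  have hE0 : ∀ S T, 0 ≤ E S T := fun S T => by
    simp only [hE]; split_ifs <;> positivity
  have hn0 : (0 : ℝ) ≤ 1 / (n : ℝ) := by positivity
  have hn1 : 1 / (n : ℝ) ≤ 1 := by
    rcases Nat.eq_zero_or_pos n with h | h
    · simp [h]
    · exact div_le_one_of_le₀ (by exact_mod_cast h) (by positivity)
  have hnn : (n : ℝ) * (1 / (n : ℝ)) ≤ 1 := by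
    rw [mul_one_div]; exact div_self_le_one _
  calc ∫ ω, coeffEnergy (M ω) ∂P
      = ∑ k ∈ Finset.range (Fintype.card (DirEdge n) + 1), (1 / 64 : ℝ) ^ (2 * k) *
          ∫ ω, ‖sumPrincipalMinors (nonbacktrackingMatrix (M ω)) k‖ ^ 2 ∂P := by
        simp only [coeffEnergy]
        rw [integral_finsetSum _ fun k _ =>
          (hM.integral_norm_sq_sumPrincipalMinors_le k).1.const_mul _]
        simp_rw [integral_const_mul]
    _ ≤ ∑ k ∈ Finset.range (Fintype.card (DirEdge n) + 1),
          ∑ S ∈ Finset.univ.powersetCard k, ∑ T, E S T := by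
        refine Finset.sum_le_sum fun k _ => ?_
        refine (mul_le_mul_of_nonneg_left (hM.integral_norm_sq_sumPrincipalMinors_le k).2
          (by positivity)).trans ?_
        rw [Finset.mul_sum]
        refine Finset.sum_le_sum fun S hS => ?_
        rw [Finset.mul_sum]
        refine (Finset.sum_le_sum fun T hT => ?_).trans
          (Finset.sum_le_sum_of_subset_of_nonneg (Finset.subset_univ _) fun T _ _ => hE0 S T)
        have h2 : 2 * k = S.card + T.card := by
          rw [(Finset.mem_powersetCard.1 hS).2, (Finset.mem_powersetCard.1 hT).2]; ring
        rw [h2]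
        exact hM.pow_mul_norm_nbMinor_mul_le S T
    _ = ∑ S, ∑ T, E S T := by
        rw [← Finset.card_univ, ← Finset.sum_powerset, Finset.powerset_univ]
    _ ≤ ∑ G : Finset (UndirEdge n), 16 ^ G.card *
          (if ∀ v, (incidentEdges G v).card ≠ 1 then
            ((1 / 16 : ℝ) ^ 2 * (1 / (n : ℝ))) ^ G.card else 0) :=
        sum_edgeSupport_le (fun G => if ∀ v, (incidentEdges G v).card ≠ 1 then
            ((1 / 16 : ℝ) ^ 2 * (1 / (n : ℝ))) ^ G.card else 0) fun G => by
          split_ifs <;> positivity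
    _ = ∑ G : Finset (UndirEdge n), (if ∀ v, (incidentEdges G v).card ≠ 1 then
            (1 / 16 * (1 / (n : ℝ))) ^ G.card else 0) := by
        refine Finset.sum_congr rfl fun G _ => ?_
        rw [mul_ite, mul_zero, ← mul_pow]
        congr 2; ring
    _ ≤ √2 := by
        refine sum_graph_card_incidentEdges_ne_one_le n _ (by positivity) ?_ ?_
        · linarith
        · linarith
    _ ≤ 2 := by
        rw [Real.sqrt_le_left (by norm_num)]; norm_num

end Energy

/-! ### The deformed Hermitian matrix of the Ihara-Bass formula -/

section IharaBass

open Matrix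

variable {n : ℕ}

theorem Matrix.mem_spectrum_of_mulVec_eq {m : Type*} [Fintype m] [DecidableEq m]
    {A : Matrix m m ℂ} {mu : ℂ} {v : m → ℂ} (hv : v ≠ 0) (h : A *ᵥ v = mu • v) :
    mu ∈ spectrum ℂ A := by
  rw [spectrum.mem_iff, Matrix.isUnit_iff_isUnit_det, isUnit_iff_ne_zero, not_not]
  refine Matrix.exists_mulVec_eq_zero_iff.1 ⟨v, hv, ?_⟩
  rw [Algebra.algebraMap_eq_smul_one, sub_mulVec, smul_mulVec, one_mulVec, h, sub_self]

theorem Matrix.exists_mulVec_eq_of_mem_spectrum {m : Type*} [Fintype m] [DecidableEq m]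
    {A : Matrix m m ℂ} {mu : ℂ} (h : mu ∈ spectrum ℂ A) : ∃ v ≠ 0, A *ᵥ v = mu • v := by
  rw [spectrum.mem_iff, Matrix.isUnit_iff_isUnit_det, isUnit_iff_ne_zero, not_not] at h
  obtain ⟨v, hv, h0⟩ := Matrix.exists_mulVec_eq_zero_iff.2 h
  rw [Algebra.algebraMap_eq_smul_one, sub_mulVec, smul_mulVec, one_mulVec, sub_eq_zero] at h0
  exact ⟨v, hv, h0.symm⟩

/-- The diagonal part of the deformed matrix in the Ihara-Bass formula at the real point `t`. -/
noncomputable def bassDiag (H : Matrix (Fin n) (Fin n) ℂ) (t : ℝ) (i : Fin n) : ℝ :=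
  1 + ∑ k, ‖H i k‖ ^ 2 / (t ^ 2 - ‖H i k‖ ^ 2)

/-- The off-diagonal part of the deformed matrix in the Ihara-Bass formula at the real point `t`:
it is close to `H / t` for large `t`. -/
noncomputable def bassOff (H : Matrix (Fin n) (Fin n) ℂ) (t : ℝ) : Matrix (Fin n) (Fin n) ℂ :=
  Matrix.of fun i j => ((t / (t ^ 2 - ‖H i j‖ ^ 2) : ℝ) : ℂ) * H i j

/-- The deformed matrix in the Ihara-Bass formula: it is singular at `t` precisely if `t` is an
eigenvalue of the nonbacktracking matrix of `H`, for `t` larger than the entries of `H`. -/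
noncomputable def bassMatrix (H : Matrix (Fin n) (Fin n) ℂ) (t : ℝ) : Matrix (Fin n) (Fin n) ℂ :=
  Matrix.diagonal (fun i => (bassDiag H t i : ℂ)) - bassOff H t

theorem Matrix.IsHermitian.norm_apply_comm {H : Matrix (Fin n) (Fin n) ℂ} (hH : H.IsHermitian)
    (i j : Fin n) : ‖H j i‖ = ‖H i j‖ := by
  rw [← hH.apply i j, norm_star]

theorem Matrix.IsHermitian.mul_apply_comm {H : Matrix (Fin n) (Fin n) ℂ} (hH : H.IsHermitian)
    (i j : Fin n) : H i j * H j i = ((‖H i j‖ ^ 2 : ℝ) : ℂ) := by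
  rw [← hH.apply j i, Complex.ofReal_pow]
  exact Complex.mul_conj' _

theorem isHermitian_bassOff {H : Matrix (Fin n) (Fin n) ℂ} (hH : H.IsHermitian) (t : ℝ) :
    (bassOff H t).IsHermitian := by
  refine Matrix.IsHermitian.ext fun i j => ?_
  simp only [bassOff, Matrix.of_apply, star_mul', hH.apply, hH.norm_apply_comm i j]
  congr 1
  exact Complex.conj_ofReal _

theorem isHermitian_bassMatrix {H : Matrix (Fin n) (Fin n) ℂ} (hH : H.IsHermitian) (t : ℝ) :
    (bassMatrix H t).IsHermitian := by
  refine Matrix.IsHermitian.sub ?_ (isHermitian_bassOff hH t)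
  refine Matrix.isHermitian_diagonal_of_self_adjoint _ ?_
  funext i
  exact Complex.conj_ofReal _

/-- A kernel vector `v` of the deformed matrix yields an eigenvector
`u (ij) = (t v j - H j i v i) / (t ^ 2 - |H i j| ^ 2)` of the nonbacktracking matrix. -/
theorem mem_spectrum_nonbacktrackingMatrix {H : Matrix (Fin n) (Fin n) ℂ} (hH : H.IsHermitian)
    (hdiag : ∀ i, H i i = 0) {t : ℝ} (ht : ∀ i j, ‖H i j‖ < t) {v : Fin n → ℂ} (hv : v ≠ 0)
    (hker : bassMatrix H t *ᵥ v = 0) : (t : ℂ) ∈ spectrum ℂ (nonbacktrackingMatrix H) := by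
  have hD : ∀ i j, (t : ℂ) ^ 2 - (‖H i j‖ : ℂ) ^ 2 ≠ 0 := by
    intro i j
    have h1 := ht i j
    have h2 := norm_nonneg (H i j)
    have : t ^ 2 - ‖H i j‖ ^ 2 ≠ 0 := by nlinarith
    exact_mod_cast this
  let U : Fin n → Fin n → ℂ := fun i j =>
    ((t : ℂ) * v j - H j i * v i) / ((t : ℂ) ^ 2 - (‖H i j‖ : ℂ) ^ 2)
  have hsum : ∀ i, ∑ j, H i j * U i j = v i := by
    intro i
    have h1 := congrFun hker i
    rw [bassMatrix, sub_mulVec, Pi.sub_apply, mulVec_diagonal, Pi.zero_apply, sub_eq_zero] at h1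
    have h2 : ∑ j, H i j * U i j = (bassOff H t *ᵥ v) i - ((bassDiag H t i : ℂ) - 1) * v i := by
      simp only [mulVec, dotProduct, bassOff, bassDiag, Matrix.of_apply]
      push_cast
      rw [add_sub_cancel_left, Finset.sum_mul, ← Finset.sum_sub_distrib]
      refine Finset.sum_congr rfl fun j _ => ?_
      have h3 := hH.mul_apply_comm i j
      push_cast at h3
      rw [← h3]
      simp only [U]
      rw [← h3]
      ring
    rw [h2, ← h1]; ring
  have hU : ∀ i j, H j i * U j i + t * U i j = v j := by
    intro i j
    have h3 := hH.mul_apply_comm j i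
    push_cast at h3
    have hd := hD i j
    simp only [U]
    rw [hH.norm_apply_comm i j] at h3 ⊢
    field_simp
    linear_combination (-v j) * h3
  refine Matrix.mem_spectrum_of_mulVec_eq (v := fun e : DirEdge n => U e.1.1 e.1.2) ?_ ?_
  · intro h0
    apply hv
    funext i
    rw [← hsum i, Pi.zero_apply]
    refine Finset.sum_eq_zero fun j _ => ?_
    by_cases hij : i = j
    · rw [hij, hdiag, zero_mul]
    · have : U i j = 0 := congrFun h0 ⟨(i, j), hij⟩
      rw [this, mul_zero]
  · funext e
    simp only [mulVec, dotProduct, nonbacktrackingMatrix, Matrix.of_apply, Pi.smul_apply,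
      smul_eq_mul]
    have h1 : ∑ f : DirEdge n, (if e.1.2 = f.1.1 ∧ e.1.1 ≠ f.1.2 then H f.1.1 f.1.2 else 0) *
        U f.1.1 f.1.2 = ∑ f : Fin n × Fin n, (if e.1.2 = f.1 ∧ e.1.1 ≠ f.2 then H f.1 f.2 else 0) *
        U f.1 f.2 := by
      let g : Fin n × Fin n → ℂ := fun f =>
        (if e.1.2 = f.1 ∧ e.1.1 ≠ f.2 then H f.1 f.2 else 0) * U f.1 f.2
      have h0 := Finset.sum_subtype (F := inferInstance)
        (p := fun f : Fin n × Fin n => f.1 ≠ f.2)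
        (Finset.univ.filter fun f : Fin n × Fin n => f.1 ≠ f.2) (by simp) g
      refine h0.symm.trans (Finset.sum_filter_of_ne fun f _ hf hf' => hf ?_)
      simp only [g]
      rw [hf', hdiag, ite_self, zero_mul]
    rw [h1, Fintype.sum_prod_type, Finset.sum_eq_single e.1.2]
    · have h2 : ∀ j, (if e.1.2 = e.1.2 ∧ e.1.1 ≠ j then H e.1.2 j else 0) * U e.1.2 j =
          H e.1.2 j * U e.1.2 j - if e.1.1 = j then H e.1.2 j * U e.1.2 j else 0 := by
        intro j
        by_cases hj : e.1.1 = j <;> simp [hj]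
      rw [Finset.sum_congr rfl fun j _ => h2 j, Finset.sum_sub_distrib, hsum, Finset.sum_ite_eq, if_pos (Finset.mem_univ _),
        ← hU e.1.1 e.1.2]
      ring
    · intro i _ hi
      refine Finset.sum_eq_zero fun j _ => ?_
      rw [if_neg (fun h => hi h.1.symm), zero_mul]
    · intro h; exact absurd (Finset.mem_univ _) h

/-- The real part of the sesquilinear form of a matrix on the diagonal. -/
noncomputable def quadForm {m : Type*} [Fintype m] (A : Matrix m m ℂ) (v : m → ℂ) : ℝ :=
  (star v ⬝ᵥ A *ᵥ v).re

theorem quadForm_sub {m : Type*} [Fintype m] (A B : Matrix m m ℂ) (v : m → ℂ) :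
    quadForm (A - B) v = quadForm A v - quadForm B v := by
  simp [quadForm, sub_mulVec, dotProduct_sub]

theorem quadForm_smul {m : Type*} [Fintype m] (c : ℝ) (A : Matrix m m ℂ) (v : m → ℂ) :
    quadForm ((c : ℂ) • A) v = c * quadForm A v := by
  simp [quadForm, smul_mulVec, dotProduct_smul]

theorem quadForm_smul_vec {m : Type*} [Fintype m] (A : Matrix m m ℂ) (c : ℝ) (v : m → ℂ) :
    quadForm A ((c : ℂ) • v) = c ^ 2 * quadForm A v := by
  simp [quadForm, mulVec_smul, dotProduct_smul, smul_dotProduct]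
  ring

theorem quadForm_diagonal {m : Type*} [Fintype m] [DecidableEq m] (d : m → ℝ) (v : m → ℂ) :
    quadForm (Matrix.diagonal fun i => (d i : ℂ)) v = ∑ i, d i * ‖v i‖ ^ 2 := by
  simp only [quadForm, dotProduct, mulVec_diagonal, Complex.re_sum, Pi.star_apply]
  refine Finset.sum_congr rfl fun i _ => ?_
  have : star (v i) * ((d i : ℂ) * v i) = ((d i * ‖v i‖ ^ 2 : ℝ) : ℂ) := by
    have := Complex.conj_mul' (v i)
    push_cast
    rw [← this]
    simp only [RCLike.star_def]; ring
  rw [this, Complex.ofReal_re]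

/-- Schur's test. -/
theorem abs_quadForm_le {m : Type*} [Fintype m] (A : Matrix m m ℂ)
    (hA : ∀ i j, ‖A j i‖ = ‖A i j‖) {s : ℝ} (hs : ∀ i, ∑ j, ‖A i j‖ ≤ s) (v : m → ℂ) :
    |quadForm A v| ≤ s * ∑ i, ‖v i‖ ^ 2 := by
  have h1 : |quadForm A v| ≤ ∑ i, ∑ j, ‖v i‖ * (‖A i j‖ * ‖v j‖) := by
    refine (Complex.abs_re_le_norm _).trans ?_
    simp only [dotProduct, mulVec]
    refine (norm_sum_le _ _).trans (Finset.sum_le_sum fun i _ => ?_)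
    rw [norm_mul, Pi.star_apply, norm_star, ← Finset.mul_sum]
    refine mul_le_mul_of_nonneg_left ((norm_sum_le _ _).trans (le_of_eq ?_)) (norm_nonneg _)
    simp only [norm_mul]
  have h2 : ∑ i, ∑ j, ‖v i‖ * (‖A i j‖ * ‖v j‖) ≤
      ∑ i, ∑ j, (‖A i j‖ * ‖v i‖ ^ 2 / 2 + ‖A j i‖ * ‖v j‖ ^ 2 / 2) := by
    refine Finset.sum_le_sum fun i _ => Finset.sum_le_sum fun j _ => ?_
    rw [hA i j]
    nlinarith [mul_nonneg (norm_nonneg (A i j)) (sq_nonneg (‖v i‖ - ‖v j‖))]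
  have h3 : ∑ i, ∑ j, ‖A j i‖ * ‖v j‖ ^ 2 / 2 = ∑ i, ∑ j, ‖A i j‖ * ‖v i‖ ^ 2 / 2 :=
    Finset.sum_comm
  have h4 : ∑ i, ∑ j, ‖A i j‖ * ‖v i‖ ^ 2 / 2 ≤ (s * ∑ i, ‖v i‖ ^ 2) / 2 := by
    rw [Finset.mul_sum, Finset.sum_div]
    refine Finset.sum_le_sum fun i _ => ?_
    rw [← Finset.sum_div, ← Finset.sum_mul]
    have := mul_le_mul_of_nonneg_right (hs i) (sq_nonneg ‖v i‖)
    linarith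
  simp_rw [Finset.sum_add_distrib] at h2
  linarith

open scoped ComplexOrder in
/-- A continuous path of nonsingular Hermitian matrices that ends at a positive semidefinite matrix
is positive semidefinite throughout: at the last time where the form fails to be positive definite
it would be degenerate. -/
theorem quadForm_nonneg_of_path {m : Type*} [Fintype m] [DecidableEq m] (A : ℝ → Matrix m m ℂ)
    {a b : ℝ} (hab : a ≤ b) (hherm : ∀ t, (A t).IsHermitian)
    (hcont : ContinuousOn A (Set.Icc a b))
    (hker : ∀ t ∈ Set.Icc a b, ∀ v, v ≠ 0 → A t *ᵥ v ≠ 0) (hb : ∀ v, 0 ≤ quadForm (A b) v)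
    (v : m → ℂ) : 0 ≤ quadForm (A a) v := by
  by_contra! hneg
  let K : Set (ℝ × (m → ℂ)) := (Set.Icc a b ×ˢ Metric.sphere 0 1) ∩
    (fun x : ℝ × (m → ℂ) => quadForm (A x.1) x.2) ⁻¹' Set.Iic 0
  have hunit : ∀ w : m → ℂ, w ≠ 0 → ((‖w‖⁻¹ : ℝ) : ℂ) • w ∈ Metric.sphere (0 : m → ℂ) 1 := by
    intro w hw
    rw [mem_sphere_zero_iff_norm, norm_smul, Complex.norm_real, norm_inv, norm_norm,
      inv_mul_cancel₀ (norm_ne_zero_iff.2 hw)]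
  have hmemK : ∀ t ∈ Set.Icc a b, ∀ w, w ≠ 0 → quadForm (A t) w ≤ 0 →
      (t, ((‖w‖⁻¹ : ℝ) : ℂ) • w) ∈ K := by
    intro t ht w hw hq
    refine ⟨⟨ht, hunit w hw⟩, ?_⟩
    simp only [Set.mem_preimage, Set.mem_Iic]
    rw [quadForm_smul_vec]
    exact mul_nonpos_of_nonneg_of_nonpos (sq_nonneg _) hq
  have hKc : IsCompact K := by
    have hS : IsCompact (Set.Icc a b ×ˢ Metric.sphere (0 : m → ℂ) 1) :=
      isCompact_Icc.prod (isCompact_sphere _ _)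
    refine hS.of_isClosed_subset ?_ Set.inter_subset_left
    refine ContinuousOn.preimage_isClosed_of_isClosed ?_ hS.isClosed isClosed_Iic
    have hA : ContinuousOn (fun x : ℝ × (m → ℂ) => A x.1)
        (Set.Icc a b ×ˢ Metric.sphere (0 : m → ℂ) 1) :=
      hcont.comp continuousOn_fst fun x hx => hx.1
    rw [continuousOn_iff_continuous_domRestrict] at hA ⊢
    have hv : Continuous fun x : (Set.Icc a b ×ˢ Metric.sphere (0 : m → ℂ) 1 :
        Set (ℝ × (m → ℂ))) => x.1.2 := continuous_snd.comp continuous_subtype_val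
    exact Complex.continuous_re.comp (hv.star.dotProduct (hA.matrix_mulVec hv))
  have hv0 : v ≠ 0 := by
    rintro rfl
    simp [quadForm] at hneg
  have hKne : K.Nonempty := ⟨_, hmemK a ⟨le_rfl, hab⟩ v hv0 hneg.le⟩
  obtain ⟨⟨t, w⟩, ⟨⟨htI, hwS⟩, hq⟩, hmax⟩ := hKc.exists_isMaxOn hKne continuousOn_fst
  simp only [Set.mem_preimage, Set.mem_Iic] at hq htI hwS
  have hnn : ∀ x, 0 ≤ quadForm (A t) x := by
    intro x
    by_cases hx : x = 0
    · simp [hx, quadForm]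
    rcases eq_or_lt_of_le htI.2 with h | h
    · rw [h]; exact hb x
    have hpos : ∀ s ∈ Set.Ioc t b, 0 ≤ quadForm (A s) x := by
      intro s hs
      by_contra! hs0
      have : s ≤ t := hmax (hmemK s ⟨htI.1.trans hs.1.le, hs.2⟩ x hx hs0.le)
      exact absurd hs.1 this.not_gt
    have hlim : Filter.Tendsto (fun s => quadForm (A s) x) (nhdsWithin t (Set.Ioc t b))
        (nhds (quadForm (A t) x)) := by
      have h1 : ContinuousWithinAt A (Set.Ioc t b) t :=
        (hcont t htI).mono fun s hs => ⟨htI.1.trans hs.1.le, hs.2⟩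
      have h2 : Continuous fun B : Matrix m m ℂ => quadForm B x :=
        Complex.continuous_re.comp (continuous_const.dotProduct
          (continuous_id.matrix_mulVec continuous_const))
      exact (h2.tendsto _).comp h1
    have : (nhdsWithin t (Set.Ioc t b)).NeBot := by
      rw [nhdsWithin_Ioc_eq_nhdsGT h]; infer_instance
    exact ge_of_tendsto hlim (Filter.eventually_of_mem self_mem_nhdsWithin hpos)
  have him : ∀ x, (star x ⬝ᵥ A t *ᵥ x).im = 0 := fun x =>
    (hherm t).im_star_dotProduct_mulVec_self x
  have hpsd : (A t).PosSemidef :=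
    Matrix.PosSemidef.of_dotProduct_mulVec_nonneg (hherm t) fun x =>
      Complex.le_def.2 ⟨hnn x, (him x).symm⟩
  have hzero : star w ⬝ᵥ A t *ᵥ w = 0 :=
    Complex.ext (le_antisymm hq (hnn w)) (him w)
  have hw0 : w ≠ 0 := by
    rintro rfl
    simp at hwS
  exact hker t htI w hw0 ((hpsd.dotProduct_mulVec_zero_iff w).1 hzero)

end IharaBass

/-! ### The spectral radius in terms of the nonbacktracking spectrum and the row norms -/

section Comparison

open Matrix

variable {n : ℕ} {H : Matrix (Fin n) (Fin n) ℂ}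

theorem norm_sq_apply_le {K : ℝ} (hrow : ∀ i, ∑ j, ‖H i j‖ ^ 2 ≤ K ^ 2) (i j : Fin n) :
    ‖H i j‖ ^ 2 ≤ K ^ 2 :=
  (Finset.single_le_sum (f := fun j => ‖H i j‖ ^ 2) (fun _ _ => by positivity)
    (Finset.mem_univ j)).trans (hrow i)

theorem three_quarters_mul_sq_le {K t : ℝ} (hK : 0 ≤ K) (ht : 2 * K ≤ t)
    (hrow : ∀ i, ∑ j, ‖H i j‖ ^ 2 ≤ K ^ 2) (i j : Fin n) :
    3 / 4 * t ^ 2 ≤ t ^ 2 - ‖H i j‖ ^ 2 := by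
  have := norm_sq_apply_le hrow i j
  nlinarith

theorem continuousOn_bassMatrix {K a : ℝ} (ha : 0 < a) (hK : 0 ≤ K) (haK : 2 * K ≤ a)
    (hrow : ∀ i, ∑ j, ‖H i j‖ ^ 2 ≤ K ^ 2) (b : ℝ) :
    ContinuousOn (bassMatrix H) (Set.Icc a b) := by
  have hD : ∀ i j, ∀ t ∈ Set.Icc a b, t ^ 2 - ‖H i j‖ ^ 2 ≠ 0 := by
    intro i j t ht
    have h1 := three_quarters_mul_sq_le hK (haK.trans ht.1) hrow i j
    have h2 : 0 < t := ha.trans_le ht.1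
    have : 0 < 3 / 4 * t ^ 2 := by positivity
    linarith
  have hd : ∀ i j, ContinuousOn (fun t : ℝ => t ^ 2 - ‖H i j‖ ^ 2) (Set.Icc a b) :=
    fun i j => by fun_prop
  refine ContinuousOn.sub ?_ ?_
  · refine continuousOn_pi.2 fun i => continuousOn_pi.2 fun j => ?_
    simp only [Matrix.diagonal_apply]
    split_ifs
    · refine Complex.continuous_ofReal.comp_continuousOn ?_
      exact continuousOn_const.add (continuousOn_finsetSum _ fun k _ =>
        continuousOn_const.div (hd i k) (hD i k))
    · exact continuousOn_const
  · refine continuousOn_pi.2 fun i => continuousOn_pi.2 fun j => ?_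
    simp only [bassOff, Matrix.of_apply]
    exact (Complex.continuous_ofReal.comp_continuousOn
      (continuousOn_id.div (hd i j) (hD i j))).mul continuousOn_const

theorem one_le_bassDiag {K t : ℝ} (hK : 0 ≤ K) (ht : 2 * K ≤ t)
    (hrow : ∀ i, ∑ j, ‖H i j‖ ^ 2 ≤ K ^ 2) (i : Fin n) : 1 ≤ bassDiag H t i := by
  refine le_add_of_nonneg_right (Finset.sum_nonneg fun j _ => div_nonneg (sq_nonneg _) ?_)
  have := three_quarters_mul_sq_le hK ht hrow i j
  nlinarith [sq_nonneg t]

theorem bassDiag_le {K t : ℝ} (ht0 : 0 < t) (hK : 0 ≤ K) (ht : 2 * K ≤ t)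
    (hrow : ∀ i, ∑ j, ‖H i j‖ ^ 2 ≤ K ^ 2) (i : Fin n) : bassDiag H t i ≤ 4 / 3 := by
  have h1 : ∑ k, ‖H i k‖ ^ 2 / (t ^ 2 - ‖H i k‖ ^ 2) ≤
      ∑ k, ‖H i k‖ ^ 2 / (3 / 4 * t ^ 2) :=
    Finset.sum_le_sum fun j _ => div_le_div_of_nonneg_left (sq_nonneg _) (by positivity)
      (three_quarters_mul_sq_le hK ht hrow i j)
  rw [← Finset.sum_div] at h1
  have h2 : (∑ k, ‖H i k‖ ^ 2) / (3 / 4 * t ^ 2) ≤ 1 / 3 := by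
    rw [div_le_iff₀ (by positivity)]
    have := hrow i
    nlinarith
  unfold bassDiag
  linarith

theorem quadForm_bassMatrix (H : Matrix (Fin n) (Fin n) ℂ) (t : ℝ) (v : Fin n → ℂ) :
    quadForm (bassMatrix H t) v = ∑ i, bassDiag H t i * ‖v i‖ ^ 2 - quadForm (bassOff H t) v := by
  rw [bassMatrix, quadForm_sub, quadForm_diagonal]

theorem quadForm_bassMatrix_nonneg_of_large {K t : ℝ} (hH : H.IsHermitian) (ht0 : 0 < t)
    (hK : 0 ≤ K) (ht : 2 * K ≤ t) (htn : 2 * n * K ≤ t) (hrow : ∀ i, ∑ j, ‖H i j‖ ^ 2 ≤ K ^ 2)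
    (v : Fin n → ℂ) : 0 ≤ quadForm (bassMatrix H t) v := by
  have hoff : ∀ i, ∑ j, ‖bassOff H t i j‖ ≤ 1 := by
    intro i
    have h1 : ∀ j, ‖bassOff H t i j‖ ≤ 4 / 3 * K / t := by
      intro j
      have hD := three_quarters_mul_sq_le hK ht hrow i j
      have hpos : 0 < 3 / 4 * t ^ 2 := by positivity
      have hh : ‖H i j‖ ≤ K := abs_le_of_sq_le_sq' (norm_sq_apply_le hrow i j) hK |>.2
      rw [bassOff, Matrix.of_apply, norm_mul, Complex.norm_real,
        Real.norm_of_nonneg (div_nonneg ht0.le (by linarith))]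
      calc t / (t ^ 2 - ‖H i j‖ ^ 2) * ‖H i j‖ ≤ t / (3 / 4 * t ^ 2) * K :=
            mul_le_mul (div_le_div_of_nonneg_left ht0.le hpos hD) hh (norm_nonneg _)
              (by positivity)
        _ = 4 / 3 * K / t := by field_simp
    calc ∑ j, ‖bassOff H t i j‖ ≤ ∑ _j : Fin n, 4 / 3 * K / t := Finset.sum_le_sum fun j _ => h1 j
      _ = n * (4 / 3 * K / t) := by simp
      _ ≤ 1 := by
          rw [← mul_div_assoc, div_le_one ht0]
          have : 0 ≤ n * K := by positivity
          linarith
  have h2 := abs_quadForm_le (bassOff H t) (isHermitian_bassOff hH t).norm_apply_comm hoff v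
  have h3 : ∑ i, ‖v i‖ ^ 2 ≤ ∑ i, bassDiag H t i * ‖v i‖ ^ 2 :=
    Finset.sum_le_sum fun i _ =>
      le_mul_of_one_le_left (sq_nonneg _) (one_le_bassDiag hK ht hrow i)
  rw [quadForm_bassMatrix]
  linarith [le_abs_self (quadForm (bassOff H t) v)]

/-- Since the deformed matrix stays positive semidefinite beyond the real nonbacktracking
eigenvalues, and its off-diagonal part is close to `H / t`, the quadratic form of `H` is bounded. -/
theorem quadForm_le {K R t : ℝ} (hH : H.IsHermitian) (hdiag : ∀ i, H i i = 0)
    (hR : ∀ lam ∈ spectrum ℂ (nonbacktrackingMatrix H), ‖lam‖ ≤ R) (hK : 0 ≤ K)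
    (hrow : ∀ i, ∑ j, ‖H i j‖ ^ 2 ≤ K ^ 2) (ht0 : 0 < t) (htR : R < t) (htK : 2 * K ≤ t)
    (v : Fin n → ℂ) : quadForm H v ≤ 2 * t * ∑ i, ‖v i‖ ^ 2 := by
  have hnK : 0 ≤ 2 * n * K := by positivity
  have hpsd : 0 ≤ quadForm (bassMatrix H t) v := by
    -- The right end of the path is so large that the row sums of `bassOff H` are at most one.
    refine quadForm_nonneg_of_path (bassMatrix H) (b := t + 2 * n * K) (by linarith)
      (isHermitian_bassMatrix hH) (continuousOn_bassMatrix ht0 hK htK hrow _) ?_ ?_ v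
    · intro s hs w hw h0
      have hs0 : 0 < s := ht0.trans_le hs.1
      have hent : ∀ i j, ‖H i j‖ < s := by
        intro i j
        have hh : ‖H i j‖ ≤ K := abs_le_of_sq_le_sq' (norm_sq_apply_le hrow i j) hK |>.2
        have := hs.1
        linarith
      have := hR _ (mem_spectrum_nonbacktrackingMatrix hH hdiag hent hw h0)
      rw [Complex.norm_real, Real.norm_of_nonneg hs0.le] at this
      linarith [hs.1]
    · exact quadForm_bassMatrix_nonneg_of_large hH (by linarith) hK (by linarith) (by linarith) hrow
  rw [quadForm_bassMatrix] at hpsd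
  -- `bassOff H t` differs from `H / t` by entries of order `‖H i j‖ ^ 3 / t ^ 3`.
  let E : Matrix (Fin n) (Fin n) ℂ := bassOff H t - ((t⁻¹ : ℝ) : ℂ) • H
  have hE : E.IsHermitian := by
    refine (isHermitian_bassOff hH t).sub ?_
    refine Matrix.IsHermitian.ext fun i j => ?_
    simp only [Matrix.smul_apply, smul_eq_mul, star_mul', hH.apply]
    congr 1
    exact Complex.conj_ofReal _
  have hErow : ∀ i, ∑ j, ‖E i j‖ ≤ 1 / 6 := by
    intro i
    have h1 : ∀ j, ‖E i j‖ ≤ 2 / 3 / t ^ 2 * ‖H i j‖ ^ 2 := by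
      intro j
      have hD := three_quarters_mul_sq_le hK htK hrow i j
      have hpos : 0 < 3 / 4 * t ^ 2 := by positivity
      have hDpos : 0 < t ^ 2 - ‖H i j‖ ^ 2 := by linarith
      have hh : ‖H i j‖ ≤ K := abs_le_of_sq_le_sq' (norm_sq_apply_le hrow i j) hK |>.2
      have hEij : E i j = ((‖H i j‖ ^ 2 / (t * (t ^ 2 - ‖H i j‖ ^ 2)) : ℝ) : ℂ) * H i j := by
        simp only [E, bassOff, Matrix.sub_apply, Matrix.of_apply, Matrix.smul_apply, smul_eq_mul]
        rw [← sub_mul, ← Complex.ofReal_sub]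
        congr 2
        field_simp
        ring
      rw [hEij, norm_mul, Complex.norm_real, Real.norm_of_nonneg (by positivity)]
      calc ‖H i j‖ ^ 2 / (t * (t ^ 2 - ‖H i j‖ ^ 2)) * ‖H i j‖
          ≤ ‖H i j‖ ^ 2 / (t * (3 / 4 * t ^ 2)) * (t / 2) := by
            refine mul_le_mul (div_le_div_of_nonneg_left (sq_nonneg _) (by positivity)
              (mul_le_mul_of_nonneg_left hD ht0.le)) (by linarith) (norm_nonneg _) (by positivity)
        _ = 2 / 3 / t ^ 2 * ‖H i j‖ ^ 2 := by field_simp; norm_num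
    calc ∑ j, ‖E i j‖ ≤ ∑ j, 2 / 3 / t ^ 2 * ‖H i j‖ ^ 2 := Finset.sum_le_sum fun j _ => h1 j
      _ = 2 / 3 / t ^ 2 * ∑ j, ‖H i j‖ ^ 2 := by rw [Finset.mul_sum]
      _ ≤ 2 / 3 / t ^ 2 * (t / 2) ^ 2 := by
          refine mul_le_mul_of_nonneg_left ((hrow i).trans ?_) (by positivity)
          exact pow_le_pow_left₀ hK (by linarith) 2
      _ = 1 / 6 := by field_simp; norm_num
  have h1 := abs_quadForm_le E hE.norm_apply_comm hErow v
  have h2 : quadForm E v = quadForm (bassOff H t) v - t⁻¹ * quadForm H v := by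
    rw [quadForm_sub, quadForm_smul]
  have h3 : ∑ i, bassDiag H t i * ‖v i‖ ^ 2 ≤ 4 / 3 * ∑ i, ‖v i‖ ^ 2 := by
    rw [Finset.mul_sum]
    exact Finset.sum_le_sum fun i _ =>
      mul_le_mul_of_nonneg_right (bassDiag_le ht0 hK htK hrow i) (sq_nonneg _)
  have h4 : t⁻¹ * quadForm H v ≤ 2 * ∑ i, ‖v i‖ ^ 2 := by
    have h5 : 0 ≤ ∑ i, ‖v i‖ ^ 2 := Finset.sum_nonneg fun _ _ => sq_nonneg _
    linarith [neg_abs_le (quadForm E v)]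
  rw [inv_mul_le_iff₀ ht0] at h4
  linarith

theorem nonbacktrackingMatrix_neg (H : Matrix (Fin n) (Fin n) ℂ) :
    nonbacktrackingMatrix (-H) = -nonbacktrackingMatrix H := by
  ext e f
  simp only [nonbacktrackingMatrix, Matrix.of_apply, Matrix.neg_apply]
  split_ifs <;> simp

theorem maxRowNorm_nonneg (H : Matrix (Fin n) (Fin n) ℂ) : 0 ≤ maxRowNorm H :=
  Real.iSup_nonneg fun _ => norm_nonneg _

theorem sum_norm_sq_le_maxRowNorm_sq (H : Matrix (Fin n) (Fin n) ℂ) (i : Fin n) :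
    ∑ j, ‖H i j‖ ^ 2 ≤ maxRowNorm H ^ 2 := by
  have h1 : ‖WithLp.toLp 2 (H i)‖ ≤ maxRowNorm H :=
    le_ciSup (f := fun i : Fin n => ‖WithLp.toLp 2 (H i)‖) (Set.finite_range _).bddAbove i
  have h2 := pow_le_pow_left₀ (norm_nonneg _) h1 2
  rwa [EuclideanSpace.norm_sq_eq] at h2

/-- The spectral radius of a Hermitian matrix with zero diagonal is controlled by that of its
nonbacktracking matrix and by its largest row norm. -/
theorem spectralRadius_le_of_nonbacktrackingMatrix (hH : H.IsHermitian) (hdiag : ∀ i, H i i = 0)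
    {R : ℝ} (hR0 : 0 ≤ R) (hR : ∀ lam ∈ spectrum ℂ (nonbacktrackingMatrix H), ‖lam‖ ≤ R) :
    spectralRadius ℂ H ≤ ENNReal.ofReal (2 * (1 + R + 2 * maxRowNorm H)) := by
  set K := maxRowNorm H
  have hK : 0 ≤ K := maxRowNorm_nonneg H
  have hrow := sum_norm_sq_le_maxRowNorm_sq H
  refine iSup₂_le fun mu hmu => ?_
  rw [← enorm_eq_nnnorm, ← ofReal_norm]
  refine ENNReal.ofReal_le_ofReal ?_
  obtain ⟨v, hv, hmv⟩ := Matrix.exists_mulVec_eq_of_mem_spectrum hmu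
  have hvv : star v ⬝ᵥ v = ((∑ i, ‖v i‖ ^ 2 : ℝ) : ℂ) := by
    simp only [dotProduct, Pi.star_apply]
    push_cast
    exact Finset.sum_congr rfl fun i _ => Complex.conj_mul' (v i)
  have hpos : 0 < ∑ i, ‖v i‖ ^ 2 := by
    obtain ⟨i, hi⟩ := Function.ne_iff.1 hv
    refine Finset.sum_pos' (fun _ _ => sq_nonneg _) ⟨i, Finset.mem_univ _, ?_⟩
    have := norm_pos_iff.2 hi
    positivity
  have hform : star v ⬝ᵥ H *ᵥ v = mu * ((∑ i, ‖v i‖ ^ 2 : ℝ) : ℂ) := by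
    rw [hmv, dotProduct_smul, hvv, smul_eq_mul]
  have him : mu.im = 0 := by
    have h1 : (star v ⬝ᵥ H *ᵥ v).im = 0 := hH.im_star_dotProduct_mulVec_self v
    rw [hform, Complex.im_mul_ofReal] at h1
    exact (mul_eq_zero.1 h1).resolve_right hpos.ne'
  have hre : quadForm H v = mu.re * ∑ i, ‖v i‖ ^ 2 := by
    rw [quadForm, hform, Complex.re_mul_ofReal]
  have hneg : quadForm (-H) v = -quadForm H v := by
    simp [quadForm, neg_mulVec]
  -- The form of `-H` is bounded as well, since the nonbacktracking spectrum changes sign with `H`.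
  have hup := quadForm_le hH hdiag hR hK hrow (t := 1 + R + 2 * K) (by linarith) (by linarith)
    (by linarith) v
  have hlow := quadForm_le (H := -H) (K := K) (R := R) (t := 1 + R + 2 * K) hH.neg
    (fun i => by simp [hdiag]) (fun lam hlam => by
      rw [nonbacktrackingMatrix_neg, ← spectrum.neg_eq, Set.mem_neg] at hlam
      simpa using hR _ hlam) hK (fun i => by simpa using hrow i) (by linarith) (by linarith)
    (by linarith) v
  rw [hneg, hre] at hlow
  rw [hre] at hup
  have hmu : mu = (mu.re : ℂ) := Complex.ext rfl (by simpa using him)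
  rw [hmu, Complex.norm_real, Real.norm_eq_abs, abs_le]
  constructor
  · by_contra! h
    nlinarith [mul_lt_mul_of_pos_right h hpos]
  · exact le_of_mul_le_mul_right hup hpos

end Comparison

/-! ### Markov's inequality for the coefficient energy -/

theorem norm_sq_le_coeffEnergy {n : ℕ} (M : Matrix (Fin n) (Fin n) ℂ) {lam : ℂ}
    (hlam : lam ∈ spectrum ℂ (nonbacktrackingMatrix M)) : ‖lam‖ ^ 2 ≤ 4096 * coeffEnergy M := by
  have := norm_sq_le_of_mem_spectrum (nonbacktrackingMatrix M) (1 / 64) (by norm_num) lam hlam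
  rw [← coeffEnergy] at this
  linarith

theorem spectralRadius_nonbacktrackingMatrix_sq_le {n : ℕ} (M : Matrix (Fin n) (Fin n) ℂ) :
    spectralRadius ℂ (nonbacktrackingMatrix M) ^ 2 ≤ ENNReal.ofReal (4096 * coeffEnergy M) := by
  have h0 : 0 ≤ 4096 * coeffEnergy M := mul_nonneg (by norm_num) (coeffEnergy_nonneg M)
  have h : spectralRadius ℂ (nonbacktrackingMatrix M) ≤
      ENNReal.ofReal (√(4096 * coeffEnergy M)) := by
    refine iSup₂_le fun lam hlam => ?_
    rw [← enorm_eq_nnnorm, ← ofReal_norm]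
    exact ENNReal.ofReal_le_ofReal (Real.le_sqrt_of_sq_le (norm_sq_le_coeffEnergy M hlam))
  calc _ ≤ ENNReal.ofReal (√(4096 * coeffEnergy M)) ^ 2 := by gcongr
    _ = _ := by rw [← ENNReal.ofReal_pow (Real.sqrt_nonneg _), Real.sq_sqrt h0]

theorem theorem2 :
    (∃ C : ℝ, 1 < C ∧
      ∀ (n : ℕ) (Ω : Type u) [MeasurableSpace Ω] (P : Measure Ω) [IsProbabilityMeasure P]
        (M : Ω → Matrix (Fin n) (Fin n) ℂ), IsNonasymptoticWigner P M →
        ∫⁻ ω, spectralRadius ℂ (nonbacktrackingMatrix (M ω)) ^ 2 ∂P ≤ ENNReal.ofReal C) ∧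
    (∀ ε : ℝ, 0 < ε → ∃ C' : ℝ, 1 < C' ∧
      ∀ (n : ℕ) (Ω : Type u) [MeasurableSpace Ω] (P : Measure Ω) [IsProbabilityMeasure P]
        (M : Ω → Matrix (Fin n) (Fin n) ℂ), IsNonasymptoticWigner P M →
        1 - ε ≤ P.real {ω | spectralRadius ℂ (M ω) ≤
          ENNReal.ofReal (C' * (1 + maxRowNorm (M ω)))}) := by
  constructor
  · refine ⟨8192, by norm_num, fun n Ω _ P _ M hM => ?_⟩
    calc ∫⁻ ω, spectralRadius ℂ (nonbacktrackingMatrix (M ω)) ^ 2 ∂P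
        ≤ ∫⁻ ω, ENNReal.ofReal (4096 * coeffEnergy (M ω)) ∂P :=
          lintegral_mono fun ω => spectralRadius_nonbacktrackingMatrix_sq_le (M ω)
      _ = ENNReal.ofReal (∫ ω, 4096 * coeffEnergy (M ω) ∂P) :=
          (ofReal_integral_eq_lintegral_ofReal (hM.integrable_coeffEnergy.const_mul _)
            (Filter.Eventually.of_forall fun ω =>
              mul_nonneg (by norm_num) (coeffEnergy_nonneg _))).symm
      _ ≤ ENNReal.ofReal 8192 := by
          refine ENNReal.ofReal_le_ofReal ?_
          rw [integral_const_mul]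
          linarith [hM.integral_coeffEnergy_le]
  · intro ε hε
    set R : ℝ := √(4096 * (2 / ε)) with hR
    have hR0 : 0 ≤ R := Real.sqrt_nonneg _
    refine ⟨4 + 2 * R, by linarith, fun n Ω _ P _ M hM => ?_⟩
    set good : Set Ω := {ω | spectralRadius ℂ (M ω) ≤
          ENNReal.ofReal ((4 + 2 * R) * (1 + maxRowNorm (M ω)))} with hgood
    -- Measurability of `good` is not needed: subadditivity of the outer measure gives
    -- `1 ≤ P good + P goodᶜ`, and Markov's inequality bounds a measurable superset of `goodᶜ`.
    have hbad : goodᶜ ⊆ {ω | 2 / ε ≤ coeffEnergy (M ω)} := by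
      intro ω hω
      by_contra hlt
      rw [Set.mem_ofPred_eq, not_le] at hlt
      apply hω
      have hle := spectralRadius_le_of_nonbacktrackingMatrix (hM.isHermitian ω)
        (hM.diag_eq_zero ω) hR0 fun lam hlam => Real.le_sqrt_of_sq_le
          ((norm_sq_le_coeffEnergy (M ω) hlam).trans (by linarith))
      refine hle.trans (ENNReal.ofReal_le_ofReal ?_)
      have hK := maxRowNorm_nonneg (M ω)
      nlinarith [mul_nonneg hR0 hK]
    have hmarkov : P.real {ω | 2 / ε ≤ coeffEnergy (M ω)} ≤ ε := by
      have h1 := mul_meas_ge_le_integral_of_nonneg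
        (Filter.Eventually.of_forall fun ω => coeffEnergy_nonneg (M ω))
        hM.integrable_coeffEnergy (2 / ε)
      have h2 := h1.trans hM.integral_coeffEnergy_le
      rw [div_mul_eq_mul_div, div_le_iff₀ hε] at h2
      linarith
    have h1 : P.real (good ∪ goodᶜ) ≤ P.real good + P.real goodᶜ := measureReal_union_le _ _
    rw [Set.union_compl_self, probReal_univ] at h1
    have h2 : P.real goodᶜ ≤ P.real {ω | 2 / ε ≤ coeffEnergy (M ω)} := measureReal_mono hbad
    linarith
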